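/- Let $n_1,\dots,n_d$ be natural numbers and, for each $r=1,\dots,d$, let $T^r=(T^r_1,\dots,T^r_{n_r})$ be a row contraction on $\mathbb{C}^2$, that is, an $n_r$-tuple of operators on $\mathbb{C}^2$ such that the row operator $[T^r_1\ \cdots\ T^r_{n_r}]:(\mathbb{C}^2)^{n_r}\to\mathbb{C}^2$ has norm at most $1$. Assume that all the operators $T^r_k$ $(1\le r\le d,\ 1\le k\le n_r)$ commute with one another. Let $\overline{\mathbb{B}_{n}}$ denote the closed Euclidean unit ball of $\mathbb{C}^{n}$. Then the closed polyball $K=\overline{\mathbb{B}_{n_1}}\times\cdots\times\overline{\mathbb{B}_{n_d}}\subset\mathbb{C}^{n_1+\cdots+n_d}$ is a complete spectral set for the commuting $(n_1+\cdots+n_d)$-tuple $T=(T^1,\dots,T^d)$. This means that $K$ is compact, that the Taylor joint spectrum $\sigma(T)$ is contained in $K$, and that for every positive integer $m$ and every $m\times m$ matrix $\rho=(p_{ij}/q_{ij})$ of rational functions, where $p_{ij},q_{ij}$ are complex polynomials in $n_1+\cdots+n_d$ variables and no $q_{ij}$ has a zero on $K$, the operators $q_{ij}(T)$ are invertible and the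 operator $\rho(T)=\bigl(p_{ij}(T)q_{ij}(T)^{-1}\bigr)_{i,j}$ on $(\mathbb{C}^2)^m$ satisfies $$\|\rho(T)\|\le\sup_{z\in K}\|\rho(z)\|,$$ with operator norms on both sides. -/

import Mathlib

open scoped TensorProduct

noncomputable section

variable {ι H : Type*} [Fintype ι] [NormedAddCommGroup H] [InnerProductSpace ℂ H]

/-- The Koszul differential `D = ∑ i, (e i ∧ ·) ⊗ A i` of a tuple `A` of operators on `H`,
acting on `Λ(ℂ^ι) ⊗ H`. For a commuting tuple it satisfies `D ∘ D = 0`. -/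
def koszulOperator [DecidableEq ι] (A : ι → H →L[ℂ] H) :
    (ExteriorAlgebra ℂ (ι → ℂ) ⊗[ℂ] H) →ₗ[ℂ] (ExteriorAlgebra ℂ (ι → ℂ) ⊗[ℂ] H) :=
  ∑ i, TensorProduct.map
    (LinearMap.mulLeft ℂ (ExteriorAlgebra.ι ℂ (Pi.single i (1 : ℂ) : ι → ℂ)))
    (A i : H →ₗ[ℂ] H)

/-- The Taylor joint spectrum of a (commuting) tuple `T`: the points `lam` such that the Koszul
complex of `T - lam` is not exact. The operator `D` raises the degree in `Λ(ℂ^ι)` by one, so the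
complex is exact in every degree if and only if `ker D = ran D`. -/
def taylorSpectrum [DecidableEq ι] (T : ι → H →L[ℂ] H) : Set (ι → ℂ) :=
  {lam | LinearMap.ker (koszulOperator fun i => T i - lam i • (1 : H →L[ℂ] H)) ≠
    LinearMap.range (koszulOperator fun i => T i - lam i • (1 : H →L[ℂ] H))}

/-- The polynomial functional calculus `p ↦ p(T)` of a commuting tuple `T`: the algebra
homomorphism that sends the variable `X i` to `T i`. It takes values in the (commutative)
subalgebra generated by the operators `T i`. -/
def polyCalculus {ι H : Type*} [NormedAddCommGroup H] [InnerProductSpace ℂ H]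
    (T : ι → H →L[ℂ] H) (hT : ∀ i j, Commute (T i) (T j)) :
    MvPolynomial ι ℂ →ₐ[ℂ] (H →L[ℂ] H) :=
  haveI : IsMulCommutative (Algebra.adjoin ℂ (Set.range T)) :=
    Algebra.isMulCommutative_adjoin ℂ (by
      rintro _ ⟨i, rfl⟩ _ ⟨j, rfl⟩
      exact hT i j)
  letI : CommRing (Algebra.adjoin ℂ (Set.range T)) :=
    { (Algebra.adjoin ℂ (Set.range T)).toRing with mul_comm := mul_comm' }
  (Algebra.adjoin ℂ (Set.range T)).val.comp
    (MvPolynomial.aeval fun i =>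
      (⟨T i, Algebra.subset_adjoin ⟨i, rfl⟩⟩ : Algebra.adjoin ℂ (Set.range T)))

theorem polyCalculus_X {ι H : Type*} [NormedAddCommGroup H] [InnerProductSpace ℂ H]
    (T : ι → H →L[ℂ] H) (hT : ∀ i j, Commute (T i) (T j)) (i : ι) :
    polyCalculus T hT (MvPolynomial.X i) = T i := by
  simp [polyCalculus]

/-- The operator on the Hilbert space direct sum `H ⊕ ⋯ ⊕ H = ℂ^m ⊗ H` given by an `m × m` matrix
of operators on `H`. -/
def blockOperator {m : ℕ} (R : Matrix (Fin m) (Fin m) (H →L[ℂ] H)) :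
    PiLp 2 (fun _ : Fin m => H) →L[ℂ] PiLp 2 (fun _ : Fin m => H) :=
  ((PiLp.continuousLinearEquiv 2 ℂ (fun _ : Fin m => H)).symm :
      (Fin m → H) →L[ℂ] PiLp 2 (fun _ : Fin m => H)) ∘L
    ContinuousLinearMap.pi fun i => ∑ j, R i j ∘L PiLp.proj 2 (fun _ : Fin m => H) j

/-- The value at the point `z` of the matrix of rational functions with entries
`P i j / Q i j`. -/
def rationalValue {m : ℕ} (P Q : Matrix (Fin m) (Fin m) (MvPolynomial ι ℂ)) (z : ι → ℂ) :
    Matrix (Fin m) (Fin m) ℂ :=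
  Matrix.of fun i j => MvPolynomial.eval z (P i j) / MvPolynomial.eval z (Q i j)

/-- The value at the commuting tuple `T` of the matrix of rational functions with entries
`P i j / Q i j`, an operator on `H ⊕ ⋯ ⊕ H`; meaningful when all `(Q i j)(T)` are invertible. -/
def rationalCalculus {m : ℕ} (P Q : Matrix (Fin m) (Fin m) (MvPolynomial ι ℂ))
    (T : ι → H →L[ℂ] H) (hT : ∀ i j, Commute (T i) (T j)) :
    PiLp 2 (fun _ : Fin m => H) →L[ℂ] PiLp 2 (fun _ : Fin m => H) :=
  blockOperator (Matrix.of fun i j =>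
    polyCalculus T hT (P i j) * Ring.inverse (polyCalculus T hT (Q i j)))

/-- The compact set `K ⊆ ℂ^ι` is a complete spectral set for the commuting tuple `T`: the Taylor
spectrum of `T` lies in `K`, and for every square matrix `r` of rational functions
`P i j / Q i j` whose denominators have no zeros on `K`, the operator `r(T)` is well defined and
`‖r(T)‖ ≤ sup_{z ∈ K} ‖r(z)‖`, with operator norms on both sides. -/
def IsCompleteSpectralSet [DecidableEq ι] (K : Set (ι → ℂ)) (T : ι → H →L[ℂ] H)
    (hT : ∀ i j, Commute (T i) (T j)) : Prop :=
  IsCompact K ∧ taylorSpectrum T ⊆ K ∧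
    ∀ (m : ℕ) (P Q : Matrix (Fin m) (Fin m) (MvPolynomial ι ℂ)),
      (∀ i j, ∀ z ∈ K, MvPolynomial.eval z (Q i j) ≠ 0) →
        (∀ i j, IsUnit (polyCalculus T hT (Q i j))) ∧
        ‖rationalCalculus P Q T hT‖ ≤
          ⨆ z : K, ‖Matrix.toEuclideanCLM (n := Fin m) (𝕜 := ℂ) (rationalValue P Q z)‖

/-- The row operator `[T 1, …, T n] : H ⊕ ⋯ ⊕ H → H`, `(x i) ↦ ∑ i, T i (x i)`. -/
def rowOperator (T : ι → H →L[ℂ] H) : PiLp 2 (fun _ : ι => H) →L[ℂ] H :=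
  ∑ i, T i ∘L PiLp.proj 2 (fun _ : ι => H) i

/-- The tuple `T` is a row contraction: its row operator is a contraction. -/
def IsRowContraction (T : ι → H →L[ℂ] H) : Prop :=
  ‖rowOperator T‖ ≤ 1

/-- The product of the closed Euclidean unit balls of `ℂ^(n 1), …, ℂ^(n d)`, as a subset of
`ℂ^(n 1 + ⋯ + n d)`. -/
def closedPolyball {d : ℕ} (n : Fin d → ℕ) : Set ((Σ r : Fin d, Fin (n r)) → ℂ) :=
  {z | ∀ r, WithLp.toLp 2 (fun k : Fin (n r) => z ⟨r, k⟩) ∈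
    Metric.closedBall (0 : EuclideanSpace ℂ (Fin (n r))) 1}

end

/-! A commuting family of operators on a two-dimensional space has a common eigenvector, so in one
orthonormal basis all of them are lower triangular (`exists_lowerOp_eq`). Commutation makes their
non-scalar parts parallel: each is `a i + s i X` for a single `X = !![0, 0; c, z]`
(`exists_common_direction`). The multivariable problem thereby becomes a one-variable one.

Suppose first that all row norms are strictly below one. In each block, `exists_affine_disc` writes
the row as `p + (α + γ X) e` with `α + γ X` a strict contraction and `w ↦ p + w e` mapping the disc
into the ball. The disc automorphism taking `α` to `0` turns `α + γ X` into a scalar multiple `g r •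
X`, again a strict contraction. Replacing `X` by `G X`, where `G` is the largest `‖g r‖`, leaves one
contraction from which every block is obtained by an analytic map of the disc into its ball
(`exists_disc_model`). So the whole tuple is `ψ (G X)` with `ψ` mapping the closed disc into the
polyball, and `ρ(T) = (ρ ∘ ψ)(G X)`.

What remains is the matrix-valued von Neumann inequality for `!![0, 0; c, z]`. Such an operator is a
compression of multiplication by the coordinate on the circle, so its functional calculus is an
average over the circle against an explicit density, and a pointwise bound integrates
(`norm_blockOperator_discCalculus_le`). The general case follows by applying this to `t T` and
letting `t` tend to `1` from below.

The Taylor spectrum is handled separately: the Koszul complex is exact once some linear combination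
of the operators is invertible, and outside the polyball a Neumann series supplies one. -/

/-! ### Exactness of the Koszul complex -/

section Koszul

variable {ι H : Type*} [Fintype ι] [DecidableEq ι] [NormedAddCommGroup H] [InnerProductSpace ℂ H]

theorem koszulOperator_tmul (A : ι → H →L[ℂ] H) (a : ExteriorAlgebra ℂ (ι → ℂ)) (x : H) :
    koszulOperator A (a ⊗ₜ x) =
      ∑ i, (ExteriorAlgebra.ι ℂ (Pi.single i (1 : ℂ) : ι → ℂ) * a) ⊗ₜ[ℂ] A i x := by
  simp [koszulOperator, LinearMap.sum_apply]

/-- Exchanging the two summation indices changes the sign of the wedge product and preserves the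
product of operators, so the double sum equals its own negative. -/
theorem koszulOperator_comp_self (A : ι → H →L[ℂ] H) (hA : ∀ i j, Commute (A i) (A j)) :
    koszulOperator A ∘ₗ koszulOperator A = 0 := by
  refine TensorProduct.ext' fun a x => ?_
  simp only [LinearMap.comp_apply, koszulOperator_tmul, map_sum, LinearMap.zero_apply]
  have hswap : ∀ i j : ι,
      (ExteriorAlgebra.ι ℂ (Pi.single i (1 : ℂ) : ι → ℂ) *
        (ExteriorAlgebra.ι ℂ (Pi.single j (1 : ℂ) : ι → ℂ) * a)) ⊗ₜ[ℂ] A i (A j x) =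
      -((ExteriorAlgebra.ι ℂ (Pi.single j (1 : ℂ) : ι → ℂ) *
        (ExteriorAlgebra.ι ℂ (Pi.single i (1 : ℂ) : ι → ℂ) * a)) ⊗ₜ[ℂ] A j (A i x)) := by
    intro i j
    have h1 : A i (A j x) = A j (A i x) := congrArg (fun B : H →L[ℂ] H => B x) (hA i j).eq
    have h2 := ExteriorAlgebra.ι_add_mul_swap (R := ℂ) (Pi.single i (1 : ℂ) : ι → ℂ)
      (Pi.single j (1 : ℂ) : ι → ℂ)
    rw [h1, ← TensorProduct.neg_tmul, ← mul_assoc, ← mul_assoc, eq_neg_of_add_eq_zero_left h2,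
      neg_mul]
  set S := ∑ j, ∑ i, (ExteriorAlgebra.ι ℂ (Pi.single i (1 : ℂ) : ι → ℂ) *
        (ExteriorAlgebra.ι ℂ (Pi.single j (1 : ℂ) : ι → ℂ) * a)) ⊗ₜ[ℂ] A i (A j x) with hS
  have h : S = -S := by
    conv_lhs => rw [hS, Finset.sum_comm]
    rw [hS, ← Finset.sum_neg_distrib]
    refine Finset.sum_congr rfl fun i _ => ?_
    rw [← Finset.sum_neg_distrib]
    exact Finset.sum_congr rfl fun j _ => hswap i j
  have h2 : (2 : ℂ) • S = 0 := by rw [two_smul, ← sub_neg_eq_add, ← h, sub_self]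
  exact (smul_eq_zero.mp h2).resolve_left two_ne_zero

/-- Contraction by the functional `φ` on the exterior algebra, tensored with the identity. -/
noncomputable def koszulHomotopy (H : Type*) [NormedAddCommGroup H] [InnerProductSpace ℂ H]
    (φ : Module.Dual ℂ (ι → ℂ)) :
    (ExteriorAlgebra ℂ (ι → ℂ) ⊗[ℂ] H) →ₗ[ℂ] (ExteriorAlgebra ℂ (ι → ℂ) ⊗[ℂ] H) :=
  (CliffordAlgebra.contractLeft φ).rTensor H

/-- Contraction is an antiderivation: contracting `e ∧ a` gives `φ e • a` minus `e ∧ (contraction of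
a)`, and the last terms cancel. It is a chain homotopy from `∑ φ(e i) A i` to zero. -/
theorem koszulOperator_homotopy (A : ι → H →L[ℂ] H) (φ : Module.Dual ℂ (ι → ℂ))
    (x : ExteriorAlgebra ℂ (ι → ℂ) ⊗[ℂ] H) :
    koszulOperator A (koszulHomotopy H φ x) + koszulHomotopy H φ (koszulOperator A x) =
      ((∑ i, φ (Pi.single i 1) • A i : H →L[ℂ] H) : H →ₗ[ℂ] H).lTensor _ x := by
  induction x with
  | zero => simp
  | add x y hx hy => simp only [map_add, ← hx, ← hy]; abel
  | tmul a x =>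
    simp only [koszulHomotopy, LinearMap.rTensor_tmul, koszulOperator_tmul, map_sum,
      LinearMap.lTensor_tmul]
    rw [← Finset.sum_add_distrib]
    simp only [ContinuousLinearMap.coe_coe, sum_apply,
      TensorProduct.tmul_sum, smul_apply, TensorProduct.tmul_smul]
    refine Finset.sum_congr rfl fun i _ => ?_
    have := CliffordAlgebra.contractLeft_ι_mul (Q := (0 : QuadraticForm ℂ (ι → ℂ))) φ
      (Pi.single i (1 : ℂ)) a
    rw [ExteriorAlgebra.ι]
    erw [this]
    rw [TensorProduct.sub_tmul, TensorProduct.smul_tmul']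
    abel

theorem koszulOperator_lTensor (A : ι → H →L[ℂ] H) (B : H →L[ℂ] H) (hB : ∀ i, Commute (A i) B)
    (x : ExteriorAlgebra ℂ (ι → ℂ) ⊗[ℂ] H) :
    koszulOperator A ((B : H →ₗ[ℂ] H).lTensor _ x) =
      (B : H →ₗ[ℂ] H).lTensor _ (koszulOperator A x) := by
  induction x with
  | zero => simp
  | add x y hx hy => simp only [map_add, hx, hy]
  | tmul a x =>
    simp only [koszulOperator_tmul, map_sum, LinearMap.lTensor_tmul]
    refine Finset.sum_congr rfl fun i _ => ?_
    congr 1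
    exact congrArg (fun C : H →L[ℂ] H => C x) (hB i).eq

theorem koszulOperator_exact (A : ι → H →L[ℂ] H) (hA : ∀ i j, Commute (A i) (A j)) (φ : ι → ℂ)
    (hφ : IsUnit (∑ i, φ i • A i)) :
    LinearMap.ker (koszulOperator A) = LinearMap.range (koszulOperator A) := by
  apply le_antisymm
  · intro x hx
    rw [LinearMap.mem_ker] at hx
    obtain ⟨U, hU⟩ := hφ
    have hc : ∀ i, Commute (A i) (↑U⁻¹ : H →L[ℂ] H) := fun i => by
      refine Commute.units_inv_right ?_
      rw [hU]
      exact Commute.sum_right _ _ _ fun j _ => (hA i j).smul_right _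
    let ψ : Module.Dual ℂ (ι → ℂ) := Fintype.linearCombination ℂ φ
    have hψ : ∀ i, ψ (Pi.single i 1) = φ i := fun i => by
      simp [ψ, Fintype.linearCombination_apply_single]
    -- The inverse commutes with every `A i`, so `y` is again a cycle; the homotopy formula then
    -- exhibits `x = U y` as the boundary of the contraction of `y`.
    set y := ((↑U⁻¹ : H →L[ℂ] H) : H →ₗ[ℂ] H).lTensor (ExteriorAlgebra ℂ (ι → ℂ)) x with hy
    have hy0 : koszulOperator A y = 0 := by rw [hy, koszulOperator_lTensor A _ hc, hx, map_zero]
    refine ⟨koszulHomotopy H ψ y, ?_⟩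
    have h := koszulOperator_homotopy A ψ y
    rw [hy0, map_zero, add_zero] at h
    simp only [hψ] at h
    rw [h, hy, ← LinearMap.comp_apply, ← LinearMap.lTensor_comp, ← hU]
    have : ((U : H →L[ℂ] H) : H →ₗ[ℂ] H) ∘ₗ ((↑U⁻¹ : H →L[ℂ] H) : H →ₗ[ℂ] H) = LinearMap.id := by
      ext v
      exact congrArg (fun C : H →L[ℂ] H => C v) U.mul_inv
    rw [this, LinearMap.lTensor_id, LinearMap.id_apply]
  · rintro _ ⟨x, rfl⟩
    exact LinearMap.congr_fun (koszulOperator_comp_self A hA) x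

end Koszul

/-! ### The closed polyball and the Taylor spectrum -/

section Polyball

variable {d : ℕ} {n : Fin d → ℕ}

theorem mem_closedPolyball_iff {z : (Σ r : Fin d, Fin (n r)) → ℂ} :
    z ∈ closedPolyball n ↔ ∀ r, ∑ k, ‖z ⟨r, k⟩‖ ^ 2 ≤ 1 := by
  refine forall_congr' fun r => ?_
  rw [mem_closedBall_zero_iff, EuclideanSpace.norm_eq, Real.sqrt_le_one]

theorem zero_mem_closedPolyball : (0 : (Σ r : Fin d, Fin (n r)) → ℂ) ∈ closedPolyball n := by
  simp [mem_closedPolyball_iff]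

theorem isCompact_closedPolyball : IsCompact (closedPolyball n) := by
  apply Metric.isCompact_of_isClosed_isBounded
  · have : closedPolyball n = ⋂ r, {z | ∑ k, ‖z ⟨r, k⟩‖ ^ 2 ≤ 1} := by
      ext z; simp [mem_closedPolyball_iff]
    rw [this]
    refine isClosed_iInter fun r => isClosed_le ?_ continuous_const
    fun_prop
  · refine isBounded_iff_forall_norm_le.2 ⟨1, fun z hz => ?_⟩
    rw [pi_norm_le_iff_of_nonneg zero_le_one]
    rintro ⟨r, k⟩
    have h1 := mem_closedPolyball_iff.1 hz r
    have h2 : ‖z ⟨r, k⟩‖ ^ 2 ≤ ∑ k, ‖z ⟨r, k⟩‖ ^ 2 :=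
      Finset.single_le_sum (f := fun k => ‖z ⟨r, k⟩‖ ^ 2) (fun _ _ => by positivity)
        (Finset.mem_univ k)
    exact (sq_le_one_iff₀ (norm_nonneg _)).1 (h2.trans h1)

variable {H : Type*} [NormedAddCommGroup H] [InnerProductSpace ℂ H]

theorem IsRowContraction.norm_sum_smul_le {ι : Type*} [Fintype ι] {T : ι → H →L[ℂ] H}
    (hT : IsRowContraction T) (c : ι → ℂ) :
    ‖∑ k, c k • T k‖ ≤ Real.sqrt (∑ k, ‖c k‖ ^ 2) := by
  refine ContinuousLinearMap.opNorm_le_bound _ (Real.sqrt_nonneg _) fun x => ?_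
  have h := (rowOperator T).le_of_opNorm_le hT (WithLp.toLp 2 fun k => c k • x)
  have h1 : rowOperator T (WithLp.toLp 2 fun k => c k • x) = (∑ k, c k • T k) x := by
    simp [rowOperator]
  rw [h1, one_mul, PiLp.norm_eq_of_L2] at h
  refine h.trans (le_of_eq ?_)
  simp only [norm_smul, mul_pow, ← Finset.sum_mul]
  rw [Real.sqrt_mul (by positivity), Real.sqrt_sq (norm_nonneg _)]

theorem taylorSpectrum_subset_closedPolyball [CompleteSpace H]
    (T : (r : Fin d) → Fin (n r) → H →L[ℂ] H) (hrow : ∀ r, IsRowContraction (T r))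
    (hcomm : ∀ i j : Σ r : Fin d, Fin (n r), Commute (T i.1 i.2) (T j.1 j.2)) :
    taylorSpectrum (fun i : Σ r : Fin d, Fin (n r) => T i.1 i.2) ⊆ closedPolyball n := by
  intro lam hlam
  by_contra hK
  apply hlam
  rw [mem_closedPolyball_iff] at hK
  push Not at hK
  obtain ⟨r, hr⟩ := hK
  set N := ∑ k, ‖lam ⟨r, k⟩‖ ^ 2 with hN
  have hN0 : (N : ℂ) ≠ 0 := by exact_mod_cast (zero_lt_one.trans hr).ne'
  -- The coefficients are the conjugates of the block of `lam` outside its ball. The resulting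
  -- combination is `B - N`, where `‖B‖ ≤ √N < N` because `N > 1`.
  refine koszulOperator_exact _ (fun i j => ?_)
    (fun i => if i.1 = r then (starRingEnd ℂ) (lam i) else 0) ?_
  · exact ((hcomm i j).sub_right ((Commute.one_right _).smul_right _)).sub_left
      ((((Commute.one_left _).sub_right ((Commute.one_right _).smul_right _))).smul_left _)
  · set B := ∑ k, (starRingEnd ℂ) (lam ⟨r, k⟩) • T r k with hB
    have hsum : (∑ i : Σ r : Fin d, Fin (n r),
        (if i.1 = r then (starRingEnd ℂ) (lam i) else 0) • (T i.1 i.2 - lam i • (1 : H →L[ℂ] H))) =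
        -((N : ℂ) • (1 - (N : ℂ)⁻¹ • B)) := by
      rw [Fintype.sum_sigma, Finset.sum_eq_single r]
      · simp only [if_true, smul_sub, Finset.sum_sub_distrib, smul_smul, ← Finset.sum_smul]
        rw [mul_inv_cancel₀ hN0, one_smul, neg_sub, ← hB]
        congr 2
        rw [hN]
        push_cast
        exact Finset.sum_congr rfl fun k _ => by
          rw [mul_comm, Complex.mul_conj, Complex.normSq_eq_norm_sq]; push_cast; rfl
      · intro s _ hs
        simp [hs]
      · simp
    rw [hsum, IsUnit.neg_iff]
    have hlt : ‖(N : ℂ)⁻¹ • B‖ < 1 := by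
      have h1 := (hrow r).norm_sum_smul_le fun k => (starRingEnd ℂ) (lam ⟨r, k⟩)
      simp only [RCLike.norm_conj] at h1
      rw [← hB, ← hN] at h1
      have hs : Real.sqrt N < N := by
        rw [Real.sqrt_lt' (by linarith)]; nlinarith
      rw [norm_smul, norm_inv, Complex.norm_real, Real.norm_of_nonneg (by linarith),
        inv_mul_lt_iff₀ (by linarith)]
      linarith
    exact (isUnit_one_sub_of_norm_lt_one hlt).smul (Units.mk0 _ hN0)

end Polyball

/-! ### Averages over the circle against two Hardy space vectors -/

section DiscCompression

open Metric ComplexConjugate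

variable {z : ℂ} {f : ℂ → ℂ}

/-- The second vector of the orthonormal basis of `span {1, k_z}` in the Hardy space, `k_z` being
the Szegő kernel at `z`; the first one is the constant `1`. -/
noncomputable def discBasis (z ζ : ℂ) : ℂ :=
  Real.sqrt (1 - ‖z‖ ^ 2) * (ζ / (1 - conj z * ζ))

theorem one_sub_conj_mul_ne_zero {z ζ : ℂ} (hz : ‖z‖ < 1) (hζ : ‖ζ‖ ≤ 1) :
    1 - conj z * ζ ≠ 0 := by
  intro h
  have h1 : ‖conj z * ζ‖ = 1 := by rw [← sub_eq_zero.1 h, norm_one]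
  rw [norm_mul, RCLike.norm_conj] at h1
  nlinarith [norm_nonneg z, norm_nonneg ζ]

theorem differentiableOn_discBasis (hz : ‖z‖ < 1) :
    DifferentiableOn ℂ (discBasis z) (closedBall 0 1) := by
  unfold discBasis
  refine DifferentiableOn.const_mul (DifferentiableOn.div (by fun_prop) (by fun_prop) ?_) _
  exact fun ζ hζ => one_sub_conj_mul_ne_zero hz (by simpa using hζ)

theorem conj_discBasis {ζ : ℂ} (hζ : ‖ζ‖ = 1) :
    conj (discBasis z ζ) = Real.sqrt (1 - ‖z‖ ^ 2) * (1 / (ζ - z)) := by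
  have h0 : ζ ≠ 0 := norm_ne_zero_iff.1 (by rw [hζ]; exact one_ne_zero)
  have h1 : conj ζ = ζ⁻¹ := by
    rw [Complex.inv_def, Complex.normSq_eq_norm_sq, hζ]; simp
  simp only [discBasis, map_mul, Complex.conj_ofReal, map_div₀, map_sub, map_one,
    Complex.conj_conj, h1]
  congr 1
  rw [show 1 - z * ζ⁻¹ = ζ⁻¹ * (ζ - z) by field_simp, div_mul_eq_div_div,
    div_self (inv_ne_zero h0)]

/-- On the circle `‖1 - conj z * ζ‖ = ‖ζ - z‖`, so integrating against the squared modulus is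
evaluation at `z`. -/
theorem conj_discBasis_mul_discBasis {ζ : ℂ} (hz : ‖z‖ < 1) (hζ : ‖ζ‖ = 1) :
    conj (discBasis z ζ) * discBasis z ζ = poissonKernel 0 z ζ := by
  have h : ‖1 - conj z * ζ‖ = ‖ζ - z‖ := by
    have h1 : conj ζ * ζ = 1 := by
      rw [mul_comm, Complex.mul_conj, Complex.normSq_eq_norm_sq, hζ]; simp
    rw [← h1, ← sub_mul, ← map_sub, norm_mul, RCLike.norm_conj, hζ, mul_one]
  rw [mul_comm, Complex.mul_conj, Complex.normSq_eq_norm_sq, discBasis, poissonKernel, norm_mul,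
    norm_div, h, hζ, Complex.norm_real, Real.norm_of_nonneg (Real.sqrt_nonneg _), mul_pow,
    Real.sq_sqrt (by nlinarith [norm_nonneg z])]
  simp [hζ, div_eq_mul_inv]

theorem circleAverage_discBasis_mul (hz : ‖z‖ < 1) (hf : DifferentiableOn ℂ f (closedBall 0 1)) :
    Real.circleAverage (fun ζ => discBasis z ζ * f ζ) 0 1 = 0 := by
  have h : DiffContOnCl ℂ (fun ζ => discBasis z ζ * f ζ) (ball 0 |1|) := by
    rw [abs_one]
    exact ((differentiableOn_discBasis hz).mul hf).diffContOnCl_ball subset_rfl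
  rw [h.circleAverage]
  simp [discBasis]

theorem circleAverage_poissonKernel_mul (hz : ‖z‖ < 1)
    (hf : DifferentiableOn ℂ f (closedBall 0 1)) :
    Real.circleAverage (fun ζ => conj (discBasis z ζ) * discBasis z ζ * f ζ) 0 1 = f z := by
  rw [← (hf.diffContOnCl_ball subset_rfl).circleAverage_poissonKernel_smul (w := z) (by simpa)]
  refine Real.circleAverage_congr_sphere fun ζ hζ => ?_
  have : ‖ζ‖ = 1 := by simpa using hζ
  simp only [conj_discBasis_mul_discBasis hz this, Pi.smul_apply', Complex.real_smul]

theorem ne_of_mem_sphere_of_norm_lt {ζ : ℂ} (hz : ‖z‖ < 1) (hζ : ‖ζ‖ = 1) : ζ - z ≠ 0 := by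
  intro h
  rw [sub_eq_zero.1 h] at hζ
  exact hz.ne hζ

theorem continuousOn_discBasis (hz : ‖z‖ < 1) : ContinuousOn (discBasis z) (sphere 0 1) :=
  (differentiableOn_discBasis hz).continuousOn.mono sphere_subset_closedBall

theorem continuousOn_conj_discBasis (hz : ‖z‖ < 1) :
    ContinuousOn (fun ζ => conj (discBasis z ζ)) (sphere 0 1) :=
  Complex.continuous_conj.comp_continuousOn (continuousOn_discBasis hz)

theorem circleAverage_conj_discBasis (hz : ‖z‖ < 1) :
    Real.circleAverage (fun ζ => conj (discBasis z ζ)) 0 1 = 0 := by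
  have h := Complex.conjCLE.toContinuousLinearMap.circleAverage_comp_comm (f := discBasis z)
    (c := 0) (R := 1) ((continuousOn_discBasis hz).circleIntegrable zero_le_one)
  have h2 := circleAverage_discBasis_mul (f := fun _ => 1) hz (by fun_prop)
  simp only [mul_one] at h2
  have h3 : Real.circleAverage (discBasis z) 0 1 = 0 := h2
  rw [h3] at h
  simpa [Function.comp_def] using h

/-- Write `f ζ = f 0 + ζ * dslope f 0 ζ`. The constant contributes zero, and since the conjugated
basis vector is a multiple of `1 / (ζ - z)` on the circle, Cauchy's formula evaluates the rest at
`z`. -/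
theorem circleAverage_conj_discBasis_mul (hz : ‖z‖ < 1)
    (hf : DifferentiableOn ℂ f (closedBall 0 1)) :
    Real.circleAverage (fun ζ => conj (discBasis z ζ) * f ζ) 0 1 =
      Real.sqrt (1 - ‖z‖ ^ 2) * dslope f 0 z := by
  have hd : DifferentiableOn ℂ (dslope f 0) (closedBall 0 1) :=
    (Complex.differentiableOn_dslope (closedBall_mem_nhds _ one_pos)).2 hf
  have h1 : Real.circleAverage (fun ζ => (ζ - 0) / (ζ - z) * dslope f 0 ζ) 0 1 = dslope f 0 z :=
    DiffContOnCl.circleAverage_smul_div (by rw [abs_one]; exact hd.diffContOnCl_ball subset_rfl)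
      (by simpa using hz)
  have hint : CircleIntegrable (fun ζ => (ζ - 0) / (ζ - z) * dslope f 0 ζ) 0 1 := by
    refine ContinuousOn.circleIntegrable zero_le_one (ContinuousOn.mul
      (ContinuousOn.div (by fun_prop) (by fun_prop) ?_)
      (hd.continuousOn.mono sphere_subset_closedBall))
    exact fun ζ hζ => ne_of_mem_sphere_of_norm_lt hz (by simpa using hζ)
  calc _ = Real.circleAverage (fun ζ => f 0 • conj (discBasis z ζ) +
          (Real.sqrt (1 - ‖z‖ ^ 2) : ℂ) • ((ζ - 0) / (ζ - z) * dslope f 0 ζ)) 0 1 := by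
        refine Real.circleAverage_congr_sphere fun ζ hζ => ?_
        have h1 : ‖ζ‖ = 1 := by simpa using hζ
        have h0 : ζ ≠ 0 := norm_ne_zero_iff.1 (by rw [h1]; exact one_ne_zero)
        have h2 := ne_of_mem_sphere_of_norm_lt hz h1
        simp only [conj_discBasis h1, smul_eq_mul]
        rw [dslope_of_ne _ h0, slope_def_field]
        field_simp
        ring
    _ = _ := by
        rw [Real.circleAverage_fun_add, Real.circleAverage_fun_smul, Real.circleAverage_fun_smul,
          circleAverage_conj_discBasis hz, h1, smul_zero, zero_add, smul_eq_mul]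
        · have h3 := continuousOn_conj_discBasis hz
          exact ContinuousOn.circleIntegrable zero_le_one (by fun_prop)
        · exact hint.const_smul

/-- The sesquilinear density of the compression of the Hardy space to `span {1, k_z}`, damped by
`μ` in the second basis vector. -/
noncomputable def compressionDensity (z μ ξ η x y ζ : ℂ) : ℂ :=
  conj (ξ + μ * discBasis z ζ * η) * (x + μ * discBasis z ζ * y) +
    (1 - ‖μ‖ ^ 2 : ℝ) * (conj (discBasis z ζ * η) * (discBasis z ζ * y))

theorem continuousOn_compressionDensity (hz : ‖z‖ < 1) (μ ξ η x y : ℂ) :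
    ContinuousOn (compressionDensity z μ ξ η x y) (sphere 0 1) := by
  have h1 := continuousOn_discBasis hz
  have h2 := continuousOn_conj_discBasis hz
  unfold compressionDensity
  simp only [map_add, map_mul]
  fun_prop

/-- The density is the pointwise inner product of images in two copies of the Hardy space: with `k =
discBasis z`, the basis goes to `(1, 0)` and `(μ k, √(1 - ‖μ‖²) k)`, an orthonormal pair.
Compressing multiplication by `f` gives a lower triangular matrix whose corner is damped by `conj
μ`, which reaches contractions of non-extremal corner size. -/
theorem circleAverage_compressionDensity (hz : ‖z‖ < 1)
    (hf : DifferentiableOn ℂ f (closedBall 0 1)) (μ ξ η x y : ℂ) :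
    Real.circleAverage (fun ζ => f ζ * compressionDensity z μ ξ η x y ζ) 0 1 =
      f 0 * (conj ξ * x) + conj μ * Real.sqrt (1 - ‖z‖ ^ 2) * dslope f 0 z * (conj η * x) +
        f z * (conj η * y) := by
  have hμ : conj μ * μ = (‖μ‖ ^ 2 : ℝ) := by
    rw [mul_comm, Complex.mul_conj, Complex.normSq_eq_norm_sq]
  have hfc := hf.continuousOn.mono sphere_subset_closedBall
  have h1 := continuousOn_discBasis hz
  have h2 := continuousOn_conj_discBasis hz
  calc _ = Real.circleAverage (fun ζ => (conj ξ * x) • f ζ + ((conj ξ * μ * y) •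
          (discBasis z ζ * f ζ) + ((conj μ * conj η * x) • (conj (discBasis z ζ) * f ζ) +
          (conj η * y) • (conj (discBasis z ζ) * discBasis z ζ * f ζ)))) 0 1 := by
        congr 1
        funext ζ
        simp only [compressionDensity, map_add, map_mul, smul_eq_mul]
        push_cast at hμ ⊢
        linear_combination (f ζ * conj η * y * conj (discBasis z ζ) * discBasis z ζ) * hμ
    _ = _ := by
        have hm : Real.circleAverage f 0 1 = f 0 :=
          DiffContOnCl.circleAverage (by rw [abs_one]; exact hf.diffContOnCl_ball subset_rfl)
        rw [Real.circleAverage_fun_add, Real.circleAverage_fun_add, Real.circleAverage_fun_add]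
        · simp only [Real.circleAverage_fun_smul, circleAverage_discBasis_mul hz hf,
            circleAverage_conj_discBasis_mul hz hf, circleAverage_poissonKernel_mul hz hf]
          rw [hm]
          simp only [smul_eq_mul]
          ring
        all_goals exact ContinuousOn.circleIntegrable zero_le_one (by fun_prop)

end DiscCompression

/-! ### Lower triangular operators and their functional calculus -/

section LowerTriangular

open Metric ComplexConjugate

variable {H : Type*} [NormedAddCommGroup H] [InnerProductSpace ℂ H]

/-- The operator with matrix `!![α, 0; β, δ]` in the orthonormal basis `b`. -/
noncomputable def lowerOp (b : OrthonormalBasis (Fin 2) ℂ H) (α β δ : ℂ) : H →L[ℂ] H :=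
  (innerSL ℂ (b 0)).smulRight (α • b 0 + β • b 1) + (innerSL ℂ (b 1)).smulRight (δ • b 1)

variable (b : OrthonormalBasis (Fin 2) ℂ H)

theorem lowerOp_apply (α β δ : ℂ) (x : H) :
    lowerOp b α β δ x =
      inner ℂ (b 0) x • (α • b 0 + β • b 1) + inner ℂ (b 1) x • (δ • b 1) := rfl

theorem inner_zero_lowerOp (α β δ : ℂ) (x : H) :
    inner ℂ (b 0) (lowerOp b α β δ x) = α * inner ℂ (b 0) x := by
  simp [lowerOp_apply, b.inner_eq_ite, mul_comm]

theorem inner_one_lowerOp (α β δ : ℂ) (x : H) :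
    inner ℂ (b 1) (lowerOp b α β δ x) = β * inner ℂ (b 0) x + δ * inner ℂ (b 1) x := by
  simp [lowerOp_apply, b.inner_eq_ite, mul_comm]

theorem OrthonormalBasis.ext_inner_fin_two {x y : H} (h0 : inner ℂ (b 0) x = inner ℂ (b 0) y)
    (h1 : inner ℂ (b 1) x = inner ℂ (b 1) y) : x = y := by
  rw [← b.sum_repr' x, ← b.sum_repr' y]
  simp [h0, h1]

theorem lowerOp_mul (α β δ α' β' δ' : ℂ) :
    lowerOp b α β δ * lowerOp b α' β' δ' =
      lowerOp b (α * α') (β * α' + δ * β') (δ * δ') := by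
  ext1 x
  refine b.ext_inner_fin_two ?_ ?_
  · simp only [mul_apply_eq_comp, inner_zero_lowerOp]; ring
  · simp only [mul_apply_eq_comp, inner_one_lowerOp, inner_zero_lowerOp]; ring

theorem lowerOp_add (α β δ α' β' δ' : ℂ) :
    lowerOp b α β δ + lowerOp b α' β' δ' = lowerOp b (α + α') (β + β') (δ + δ') := by
  ext1 x
  refine b.ext_inner_fin_two ?_ ?_
  · simp only [add_apply, inner_add_right, inner_zero_lowerOp]; ring
  · simp only [add_apply, inner_add_right, inner_one_lowerOp]; ring

theorem lowerOp_scalar (α : ℂ) : lowerOp b α 0 α = α • (1 : H →L[ℂ] H) := by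
  ext1 x
  refine b.ext_inner_fin_two ?_ ?_
  · simp [inner_zero_lowerOp]
  · simp [inner_one_lowerOp]

theorem lowerOp_injective {α β δ α' β' δ' : ℂ} (h : lowerOp b α β δ = lowerOp b α' β' δ') :
    α = α' ∧ β = β' ∧ δ = δ' := by
  have h0 := inner_zero_lowerOp b α β δ (b 0)
  have h1 := inner_one_lowerOp b α β δ (b 0)
  have h2 := inner_one_lowerOp b α β δ (b 1)
  rw [h] at h0 h1 h2
  simp only [inner_zero_lowerOp, inner_one_lowerOp, b.inner_eq_ite] at h0 h1 h2
  simp at h0 h1 h2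
  exact ⟨h0.symm, h1.symm, h2.symm⟩

theorem inner_lowerOp (α β δ : ℂ) (x y : H) :
    inner ℂ y (lowerOp b α β δ x) =
      α * (conj (inner ℂ (b 0) y) * inner ℂ (b 0) x) +
      β * (conj (inner ℂ (b 1) y) * inner ℂ (b 0) x) +
      δ * (conj (inner ℂ (b 1) y) * inner ℂ (b 1) x) := by
  rw [← b.sum_inner_mul_inner y, Fin.sum_univ_two, inner_zero_lowerOp, inner_one_lowerOp,
    inner_conj_symm, inner_conj_symm]
  ring

theorem dslope_zero_mul {f g : ℂ → ℂ} {z : ℂ} (hf : DifferentiableAt ℂ f 0)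
    (hg : DifferentiableAt ℂ g 0) :
    dslope (fun w => f w * g w) 0 z = dslope f 0 z * g 0 + f z * dslope g 0 z := by
  rcases eq_or_ne z 0 with rfl | hz
  · simp only [dslope_same]
    exact deriv_fun_mul hf hg
  · simp only [dslope_of_ne _ hz, slope_def_field]
    field_simp
    ring

theorem dslope_zero_add {f g : ℂ → ℂ} {z : ℂ} (hf : DifferentiableAt ℂ f 0)
    (hg : DifferentiableAt ℂ g 0) :
    dslope (fun w => f w + g w) 0 z = dslope f 0 z + dslope g 0 z := by
  rcases eq_or_ne z 0 with rfl | hz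
  · simp only [dslope_same]
    exact deriv_fun_add hf hg
  · simp only [dslope_of_ne _ hz, slope_def_field]
    field_simp
    ring

/-- The value of a holomorphic function `f` at the operator with matrix `!![0, 0; c, z]` in the
orthonormal basis `b`. -/
noncomputable def discCalculus (c z : ℂ) (f : ℂ → ℂ) : H →L[ℂ] H :=
  lowerOp b (f 0) (c * dslope f 0 z) (f z)

variable {c z : ℂ}

/-- The corner entry is a multiple of the difference quotient between the eigenvalues `0` and `z` (a
derivative if `z = 0`), and its Leibniz rule is the corner of a triangular product. -/
theorem discCalculus_mul {f g : ℂ → ℂ} (hf : DifferentiableAt ℂ f 0)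
    (hg : DifferentiableAt ℂ g 0) :
    discCalculus b c z (fun w => f w * g w) = discCalculus b c z f * discCalculus b c z g := by
  rw [discCalculus, discCalculus, discCalculus, lowerOp_mul, dslope_zero_mul hf hg]
  congr 1
  ring

theorem discCalculus_add {f g : ℂ → ℂ} (hf : DifferentiableAt ℂ f 0)
    (hg : DifferentiableAt ℂ g 0) :
    discCalculus b c z (fun w => f w + g w) = discCalculus b c z f + discCalculus b c z g := by
  rw [discCalculus, discCalculus, discCalculus, lowerOp_add, dslope_zero_add hf hg, mul_add]

theorem discCalculus_const (a : ℂ) : discCalculus b c z (fun _ => a) = a • (1 : H →L[ℂ] H) := by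
  have : dslope (fun _ : ℂ => a) 0 z = 0 := by
    rcases eq_or_ne z 0 with rfl | hz
    · simp
    · simp [dslope_of_ne _ hz, slope_def_field]
  rw [discCalculus, this, mul_zero, lowerOp_scalar]

theorem inner_discCalculus {f : ℂ → ℂ} {μ : ℂ} (hz : ‖z‖ < 1)
    (hf : DifferentiableOn ℂ f (closedBall 0 1)) (x y : H) :
    inner ℂ y (discCalculus b (conj μ * Real.sqrt (1 - ‖z‖ ^ 2)) z f x) =
      Real.circleAverage (fun ζ => f ζ * compressionDensity z μ (inner ℂ (b 0) y)
        (inner ℂ (b 1) y) (inner ℂ (b 0) x) (inner ℂ (b 1) x) ζ) 0 1 := by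
  rw [circleAverage_compressionDensity hz hf, discCalculus, inner_lowerOp]

theorem polyCalculus_C {ι : Type*} (T : ι → H →L[ℂ] H) (hT : ∀ i j, Commute (T i) (T j)) (a : ℂ) :
    polyCalculus T hT (MvPolynomial.C a) = a • (1 : H →L[ℂ] H) := by
  rw [← MvPolynomial.algebraMap_eq, AlgHom.commutes, Algebra.algebraMap_eq_smul_one]

theorem differentiableOn_eval_comp {ι : Type*} {s : Set ℂ} {ψ : ι → ℂ → ℂ}
    (hψ : ∀ i, DifferentiableOn ℂ (ψ i) s) (p : MvPolynomial ι ℂ) :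
    DifferentiableOn ℂ (fun w => MvPolynomial.eval (fun i => ψ i w) p) s := by
  induction p using MvPolynomial.induction_on with
  | C a => simp
  | add p q hp hq => simpa using hp.fun_add hq
  | mul_X p i hp => simpa using hp.fun_mul (hψ i)

theorem polyCalculus_eq_discCalculus {ι : Type*} (T : ι → H →L[ℂ] H)
    (hT : ∀ i j, Commute (T i) (T j)) {ψ : ι → ℂ → ℂ}
    (hψ : ∀ i, DifferentiableOn ℂ (ψ i) (closedBall 0 1))
    (hTψ : ∀ i, T i = discCalculus b c z (ψ i)) (p : MvPolynomial ι ℂ) :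
    polyCalculus T hT p =
      discCalculus b c z (fun w => MvPolynomial.eval (fun i => ψ i w) p) := by
  have h0 : closedBall (0 : ℂ) 1 ∈ nhds 0 := closedBall_mem_nhds _ one_pos
  have hd := fun p => (differentiableOn_eval_comp hψ p).differentiableAt h0
  induction p using MvPolynomial.induction_on with
  | C a => simp only [polyCalculus_C, MvPolynomial.eval_C, discCalculus_const]
  | add p q hp hq =>
    simp only [map_add, hp, hq]
    rw [discCalculus_add b (hd p) (hd q)]
  | mul_X p i hp =>
    simp only [map_mul, hp, polyCalculus_X, MvPolynomial.eval_X, hTψ i]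
    rw [discCalculus_mul b (hd p) ((hψ i).differentiableAt h0)]

end LowerTriangular

/-! ### Matrix-valued von Neumann inequality -/

section BlockOperator

open Metric ComplexConjugate

variable {H : Type*} [NormedAddCommGroup H] [InnerProductSpace ℂ H] {m : ℕ}

theorem blockOperator_apply (R : Matrix (Fin m) (Fin m) (H →L[ℂ] H))
    (X : PiLp 2 (fun _ : Fin m => H)) (i : Fin m) :
    blockOperator R X i = ∑ j, R i j (X j) := by
  simp [blockOperator]

theorem inner_blockOperator (R : Matrix (Fin m) (Fin m) (H →L[ℂ] H))
    (X Y : PiLp 2 (fun _ : Fin m => H)) :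
    inner ℂ Y (blockOperator R X) = ∑ i, ∑ j, inner ℂ (Y i) (R i j (X j)) := by
  simp [PiLp.inner_apply, blockOperator_apply, inner_sum]

theorem re_sum_mul_le_of_opNorm_le (F : Matrix (Fin m) (Fin m) ℂ) {M : ℝ}
    (hF : ‖Matrix.toEuclideanCLM (n := Fin m) (𝕜 := ℂ) F‖ ≤ M) (p q : Fin m → ℂ) :
    (∑ i, ∑ j, F i j * (conj (p i) * q j)).re ≤
      M / 2 * (∑ i, ‖p i‖ ^ 2 + ∑ j, ‖q j‖ ^ 2) := by
  have h1 : ∑ i, ∑ j, F i j * (conj (p i) * q j) = inner ℂ (WithLp.toLp 2 p)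
      (Matrix.toEuclideanCLM (n := Fin m) (𝕜 := ℂ) F (WithLp.toLp 2 q)) := by
    rw [Matrix.toEuclideanCLM_toLp, PiLp.inner_apply]
    refine Finset.sum_congr rfl fun i _ => ?_
    simp only [Matrix.mulVec, dotProduct, RCLike.inner_apply, Finset.sum_mul]
    exact Finset.sum_congr rfl fun j _ => by ring
  have h2 : ∑ i, ‖p i‖ ^ 2 = ‖WithLp.toLp 2 p‖ ^ 2 := by
    rw [EuclideanSpace.norm_sq_eq]
  have h3 : ∑ i, ‖q i‖ ^ 2 = ‖WithLp.toLp 2 q‖ ^ 2 := by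
    rw [EuclideanSpace.norm_sq_eq]
  rw [h1, h2, h3]
  have hM : 0 ≤ M := (norm_nonneg _).trans hF
  refine (Complex.re_le_norm _).trans ((norm_inner_le_norm _ _).trans ?_)
  have h4 := (Matrix.toEuclideanCLM (n := Fin m) (𝕜 := ℂ) F).le_of_opNorm_le hF (WithLp.toLp 2 q)
  have h5 := mul_le_mul_of_nonneg_left h4 (norm_nonneg (WithLp.toLp 2 p))
  nlinarith [two_mul_le_add_sq ‖WithLp.toLp 2 p‖ ‖WithLp.toLp 2 q‖]

/-- The density is a sum of two rank-one pairings with nonnegative weights `1` and `1 - ‖μ‖²`; the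
norm bound on `F` applies to each. The arithmetic-mean form of the right side is linear in the
densities, so it can be averaged. -/
theorem re_sum_mul_compressionDensity_le (F : Matrix (Fin m) (Fin m) ℂ) {M : ℝ}
    (hF : ‖Matrix.toEuclideanCLM (n := Fin m) (𝕜 := ℂ) F‖ ≤ M) {z μ ζ : ℂ} (hμ : ‖μ‖ ≤ 1)
    (ξ η x y : Fin m → ℂ) :
    (∑ i, ∑ j, F i j * compressionDensity z μ (ξ i) (η i) (x j) (y j) ζ).re ≤
      M / 2 * (∑ i, (compressionDensity z μ (ξ i) (η i) (ξ i) (η i) ζ).re +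
        ∑ j, (compressionDensity z μ (x j) (y j) (x j) (y j) ζ).re) := by
  have hν : 0 ≤ 1 - ‖μ‖ ^ 2 := by nlinarith [norm_nonneg μ]
  have h1 := re_sum_mul_le_of_opNorm_le F hF (fun i => ξ i + μ * discBasis z ζ * η i)
    (fun i => x i + μ * discBasis z ζ * y i)
  have h2 := re_sum_mul_le_of_opNorm_le F hF (fun i => discBasis z ζ * η i)
    (fun i => discBasis z ζ * y i)
  have hdiag : ∀ s t : ℂ, (compressionDensity z μ s t s t ζ).re =
      ‖s + μ * discBasis z ζ * t‖ ^ 2 + (1 - ‖μ‖ ^ 2) * ‖discBasis z ζ * t‖ ^ 2 := fun s t => by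
    rw [compressionDensity, ← Complex.normSq_eq_conj_mul_self, ← Complex.normSq_eq_conj_mul_self,
      Complex.normSq_eq_norm_sq, Complex.normSq_eq_norm_sq]
    norm_cast
  have hsplit : ∑ i, ∑ j, F i j * compressionDensity z μ (ξ i) (η i) (x j) (y j) ζ =
      ∑ i, ∑ j, F i j * (conj (ξ i + μ * discBasis z ζ * η i) * (x j + μ * discBasis z ζ * y j)) +
      (1 - ‖μ‖ ^ 2 : ℝ) * ∑ i, ∑ j, F i j * (conj (discBasis z ζ * η i) *
        (discBasis z ζ * y j)) := by
    simp only [Finset.mul_sum, ← Finset.sum_add_distrib, compressionDensity]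
    exact Finset.sum_congr rfl fun i _ => Finset.sum_congr rfl fun j _ => by ring
  rw [hsplit, Complex.add_re, Complex.re_ofReal_mul]
  simp only [hdiag, Finset.sum_add_distrib, ← Finset.mul_sum]
  have h3 := mul_le_mul_of_nonneg_left h2 hν
  linarith

theorem circleAverage_re {g : ℂ → ℂ} (hg : CircleIntegrable g 0 1) :
    Real.circleAverage (fun ζ => (g ζ).re) 0 1 = (Real.circleAverage g 0 1).re :=
  Complex.reCLM.circleAverage_comp_comm hg

theorem norm_blockOperator_discCalculus_le (b : OrthonormalBasis (Fin 2) ℂ H) {c z : ℂ}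
    (hcz : ‖c‖ ^ 2 + ‖z‖ ^ 2 ≤ 1) (hz : ‖z‖ < 1) (F : Matrix (Fin m) (Fin m) (ℂ → ℂ))
    (hF : ∀ i j, DifferentiableOn ℂ (F i j) (closedBall 0 1)) {M : ℝ} (hM : 0 ≤ M)
    (hFM : ∀ ζ : ℂ, ‖ζ‖ = 1 → ‖Matrix.toEuclideanCLM (n := Fin m) (𝕜 := ℂ)
      (Matrix.of fun i j => F i j ζ)‖ ≤ M) :
    ‖blockOperator (Matrix.of fun i j => discCalculus b c z (F i j))‖ ≤ M := by
  have hz2 : 0 < 1 - ‖z‖ ^ 2 := by nlinarith [norm_nonneg z]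
  have hs : 0 < Real.sqrt (1 - ‖z‖ ^ 2) := Real.sqrt_pos.2 hz2
  -- Contractivity says `‖c‖ ≤ √(1 - ‖z‖²)`, so `μ` is the ratio, conjugated.
  obtain ⟨μ, hμ, hc⟩ : ∃ μ : ℂ, ‖μ‖ ≤ 1 ∧ c = conj μ * Real.sqrt (1 - ‖z‖ ^ 2) := by
    refine ⟨conj (c / Real.sqrt (1 - ‖z‖ ^ 2)), ?_, ?_⟩
    · rw [RCLike.norm_conj, norm_div, Complex.norm_real, Real.norm_of_nonneg hs.le,
        div_le_one hs]
      exact Real.le_sqrt_of_sq_le (by linarith)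
    · have : (Real.sqrt (1 - ‖z‖ ^ 2) : ℂ) ≠ 0 := by exact_mod_cast hs.ne'
      rw [Complex.conj_conj]
      field_simp
  subst hc
  have hcont : ∀ i j (ξ η x y : ℂ), CircleIntegrable
      (fun ζ => F i j ζ * compressionDensity z μ ξ η x y ζ) 0 1 := fun i j ξ η x y =>
    ContinuousOn.circleIntegrable zero_le_one
      (((hF i j).continuousOn.mono sphere_subset_closedBall).mul
        (continuousOn_compressionDensity hz _ _ _ _ _))
  have hcont1 : ∀ (ξ η x y : ℂ), CircleIntegrable (compressionDensity z μ ξ η x y) 0 1 :=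
    fun ξ η x y => ContinuousOn.circleIntegrable zero_le_one
      (continuousOn_compressionDensity hz _ _ _ _ _)
  have hcont2 : ∀ (ξ η x y : ℂ), CircleIntegrable
      (fun ζ => (compressionDensity z μ ξ η x y ζ).re) 0 1 :=
    fun ξ η x y => ContinuousOn.circleIntegrable zero_le_one
      (Complex.continuous_re.comp_continuousOn (continuousOn_compressionDensity hz _ _ _ _ _))
  -- The case `f = 1`: the embedding behind the density is isometric.
  have hdiag : ∀ x : H, Real.circleAverage (fun ζ => (compressionDensity z μ (inner ℂ (b 0) x)
      (inner ℂ (b 1) x) (inner ℂ (b 0) x) (inner ℂ (b 1) x) ζ).re) 0 1 = ‖x‖ ^ 2 := fun x => by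
    have h := inner_discCalculus b (f := fun _ => 1) (μ := μ) hz (by fun_prop) x x
    simp only [discCalculus_const, one_smul, one_mul] at h
    rw [circleAverage_re (hcont1 _ _ _ _), ← h, one_apply_eq_self,
      inner_self_eq_norm_sq_to_K]
    norm_cast
  have hsum : ∀ X : PiLp 2 (fun _ : Fin m => H),
      CircleIntegrable (fun ζ => ∑ i, (compressionDensity z μ (inner ℂ (b 0) (X i))
        (inner ℂ (b 1) (X i)) (inner ℂ (b 0) (X i)) (inner ℂ (b 1) (X i)) ζ).re) 0 1 :=
    fun X => CircleIntegrable.fun_sum _ fun i _ => hcont2 _ _ _ _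
  have hnorm : ∀ X : PiLp 2 (fun _ : Fin m => H),
      Real.circleAverage (fun ζ => ∑ i, (compressionDensity z μ (inner ℂ (b 0) (X i))
        (inner ℂ (b 1) (X i)) (inner ℂ (b 0) (X i)) (inner ℂ (b 1) (X i)) ζ).re) 0 1 =
        ‖X‖ ^ 2 := fun X => by
    rw [Real.circleAverage_fun_sum fun i _ => hcont2 _ _ _ _, PiLp.norm_sq_eq_of_L2]
    exact Finset.sum_congr rfl fun i _ => hdiag (X i)
  refine ContinuousLinearMap.opNorm_le_of_re_inner_le hM fun X Y hX hY => ?_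
  have hint : CircleIntegrable (fun ζ => ∑ i, ∑ j, F i j ζ * compressionDensity z μ
      (inner ℂ (b 0) (Y i)) (inner ℂ (b 1) (Y i)) (inner ℂ (b 0) (X j)) (inner ℂ (b 1) (X j)) ζ)
      0 1 :=
    CircleIntegrable.fun_sum _ fun i _ => CircleIntegrable.fun_sum _ fun j _ => hcont i j _ _ _ _
  have hrepr : inner ℂ Y (blockOperator (Matrix.of fun i j =>
      discCalculus b (conj μ * Real.sqrt (1 - ‖z‖ ^ 2)) z (F i j)) X) =
      Real.circleAverage (fun ζ => ∑ i, ∑ j, F i j ζ * compressionDensity z μ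
        (inner ℂ (b 0) (Y i)) (inner ℂ (b 1) (Y i)) (inner ℂ (b 0) (X j))
        (inner ℂ (b 1) (X j)) ζ) 0 1 := by
    rw [inner_blockOperator, Real.circleAverage_fun_sum fun i _ =>
      CircleIntegrable.fun_sum _ fun j _ => hcont i j _ _ _ _]
    refine Finset.sum_congr rfl fun i _ => ?_
    rw [Real.circleAverage_fun_sum fun j _ => hcont i j _ _ _ _]
    exact Finset.sum_congr rfl fun j _ => inner_discCalculus b hz (hF i j) _ _
  have hM2 : M = M / 2 * (‖Y‖ ^ 2 + ‖X‖ ^ 2) := by rw [hX, hY]; ring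
  rw [inner_re_symm, hM2, hrepr, RCLike.re_eq_complex_re, ← circleAverage_re hint, ← hnorm X,
    ← hnorm Y,
    ← Real.circleAverage_fun_add (hsum Y) (hsum X), ← smul_eq_mul, ← Real.circleAverage_fun_smul]
  refine Real.circleAverage_mono ?_ ?_ fun ζ hζ => ?_
  · exact ContinuousOn.circleIntegrable zero_le_one (Complex.continuous_re.comp_continuousOn
      (continuousOn_finsetSum _ fun i _ => continuousOn_finsetSum _ fun j _ =>
        ((hF i j).continuousOn.mono sphere_subset_closedBall).mul
          (continuousOn_compressionDensity hz _ _ _ _ _)))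
  · exact ((hsum Y).add (hsum X)).const_smul
  · exact re_sum_mul_compressionDensity_le (Matrix.of fun i j => F i j ζ)
      (hFM ζ (by simpa using hζ)) hμ _ _ _ _

end BlockOperator

/-! ### Simultaneous triangularization of commuting operators -/

section Triangularization

open Metric ComplexConjugate

variable {ι H : Type*} [NormedAddCommGroup H] [InnerProductSpace ℂ H]

/-- An eigenspace of a non-scalar member is a line, and it is invariant under everything that
commutes with that member. -/
theorem exists_common_eigenvector_of_finrank_eq_two [FiniteDimensional ℂ H]
    (hH : Module.finrank ℂ H = 2)
    (T : ι → H →L[ℂ] H) (hT : ∀ i j, Commute (T i) (T j)) :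
    ∃ v : H, v ≠ 0 ∧ ∀ i, ∃ c : ℂ, T i v = c • v := by
  have : Nontrivial H := Module.nontrivial_of_finrank_pos (R := ℂ) (by omega)
  by_cases hscal : ∀ i, ∃ c : ℂ, ∀ x, T i x = c • x
  · obtain ⟨v, hv⟩ := exists_ne (0 : H)
    exact ⟨v, hv, fun i => (hscal i).imp fun c hc => hc v⟩
  · push Not at hscal
    obtain ⟨i, hi⟩ := hscal
    obtain ⟨c, hc⟩ := Module.End.exists_eigenvalue (T i : H →ₗ[ℂ] H)
    obtain ⟨v, hv⟩ := hc.exists_hasEigenvector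
    refine ⟨v, hv.2, fun j => ?_⟩
    set E := Module.End.eigenspace (T i : H →ₗ[ℂ] H) c with hE
    have hlt : Module.finrank ℂ E < 2 := by
      rw [← hH]
      refine Submodule.finrank_lt (lt_top_iff_ne_top.2 fun htop => ?_).ne
      obtain ⟨x, hx⟩ := hi c
      exact hx (Module.End.mem_eigenspace_iff.1 (by rw [← hE, htop]; trivial))
    have hone : Module.finrank ℂ E = 1 := by
      have : 0 < Module.finrank ℂ E :=
        Module.finrank_pos_iff_exists_ne_zero.2 ⟨⟨v, hv.1⟩, fun h => hv.2 (congrArg Subtype.val h)⟩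
      omega
    have hmem : T j v ∈ E := by
      rw [hE, Module.End.mem_eigenspace_iff]
      have h1 : T i (T j v) = T j (T i v) := congrArg (fun B : H →L[ℂ] H => B v) (hT i j).eq
      have h2 : T i v = c • v := hv.apply_eq_smul
      simp [h1, h2]
    obtain ⟨a, ha⟩ := (finrank_eq_one_iff_of_nonzero' (⟨v, hv.1⟩ : E)
      fun h => hv.2 (congrArg Subtype.val h)).1 hone ⟨T j v, hmem⟩
    exact ⟨a, (congrArg Subtype.val ha).symm⟩

theorem exists_lowerOp_eq [FiniteDimensional ℂ H] (hH : Module.finrank ℂ H = 2)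
    (T : ι → H →L[ℂ] H) (hT : ∀ i j, Commute (T i) (T j)) :
    ∃ (b : OrthonormalBasis (Fin 2) ℂ H) (α β δ : ι → ℂ), ∀ i, T i = lowerOp b (α i) (β i) (δ i) := by
  obtain ⟨v, hv, hTv⟩ := exists_common_eigenvector_of_finrank_eq_two hH T hT
  choose δ hδ using hTv
  have hv' : (‖v‖ : ℂ) ≠ 0 := by exact_mod_cast norm_ne_zero_iff.2 hv
  obtain ⟨b, hb⟩ := Orthonormal.exists_orthonormalBasis_extension_of_card_eq (𝕜 := ℂ) (E := H)
    (ι := Fin 2) (by simp [hH]) (v := fun _ => (‖v‖ : ℂ)⁻¹ • v) (s := {1})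
    ⟨fun i => by simp [norm_smul, hv], fun i j hij => (hij (Subsingleton.elim i j)).elim⟩
  have hb1 : ∀ i, T i (b 1) = δ i • b 1 := fun i => by
    rw [hb 1 rfl, map_smul, hδ, smul_comm]
  refine ⟨b, fun i => inner ℂ (b 0) (T i (b 0)), fun i => inner ℂ (b 1) (T i (b 0)), δ,
    fun i => ?_⟩
  have h0 : T i (b 0) = inner ℂ (b 0) (T i (b 0)) • b 0 + inner ℂ (b 1) (T i (b 0)) • b 1 := by
    rw [← Fin.sum_univ_two (f := fun j => inner ℂ (b j) (T i (b 0)) • b j), b.sum_repr']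
  ext1 x
  rw [lowerOp_apply, ← h0, ← hb1, ← (T i).map_smul, ← (T i).map_smul, ← (T i).map_add]
  congr 1
  rw [← Fin.sum_univ_two (f := fun j => inner ℂ (b j) x • b j), b.sum_repr']

/-- The corner of the commutator vanishes exactly when the vectors `(β i, δ i - α i)` and `(β j, δ j
- α j)` are parallel; any nonzero one serves as the direction `(c, z)`. -/
theorem exists_common_direction (b : OrthonormalBasis (Fin 2) ℂ H) {α β δ : ι → ℂ}
    (h : ∀ i j, Commute (lowerOp b (α i) (β i) (δ i)) (lowerOp b (α j) (β j) (δ j))) :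
    ∃ (s : ι → ℂ) (c z : ℂ), ∀ i, β i = s i * c ∧ δ i = α i + s i * z := by
  have hcomm : ∀ i j, β i * (δ j - α j) = β j * (δ i - α i) := fun i j => by
    have := (h i j).eq
    rw [lowerOp_mul, lowerOp_mul] at this
    linear_combination -(lowerOp_injective b this).2.1
  by_cases hall : ∀ i, β i = 0 ∧ δ i - α i = 0
  · exact ⟨0, 0, 0, fun i => ⟨by simp [hall i], by
      simpa using sub_eq_zero.1 (hall i).2⟩⟩
  · push Not at hall
    obtain ⟨j, hj⟩ := hall
    by_cases hβ : β j = 0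
    · have hz := hj hβ
      refine ⟨fun i => (δ i - α i) / (δ j - α j), β j, δ j - α j, fun i => ⟨?_, ?_⟩⟩
      · field_simp
        linear_combination hcomm i j
      · field_simp
        ring
    · refine ⟨fun i => β i / β j, β j, δ j - α j, fun i => ⟨?_, ?_⟩⟩
      · field_simp
      · field_simp
        linear_combination -hcomm i j

/-- This bounds the adjoint of the row operator, which is a column: `X` below is that adjoint
applied to `y`, whence `⟪y, rowOperator T X⟫ = ‖X‖²`. -/
theorem sum_norm_sq_le_of_rowOperator {κ : Type*} [Fintype κ] (b : OrthonormalBasis (Fin 2) ℂ H)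
    {α β δ : κ → ℂ} {T : κ → H →L[ℂ] H} (hT : ∀ k, T k = lowerOp b (α k) (β k) (δ k)) (ξ η : ℂ) :
    ∑ k, (‖ξ * α k + η * β k‖ ^ 2 + ‖η * δ k‖ ^ 2) ≤
      ‖rowOperator T‖ ^ 2 * (‖ξ‖ ^ 2 + ‖η‖ ^ 2) := by
  have hnorm : ∀ x y : ℂ, ‖x • b 0 + y • b 1‖ ^ 2 = ‖x‖ ^ 2 + ‖y‖ ^ 2 := fun x y => by
    rw [← b.sum_sq_norm_inner_right]
    simp [inner_add_right, inner_smul_right, b.inner_eq_ite]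
  set y : H := conj ξ • b 0 + conj η • b 1 with hy
  set X : PiLp 2 (fun _ : κ => H) := WithLp.toLp 2 fun k =>
    conj (ξ * α k + η * β k) • b 0 + conj (η * δ k) • b 1 with hX
  have hXn : ‖X‖ ^ 2 = ∑ k, (‖ξ * α k + η * β k‖ ^ 2 + ‖η * δ k‖ ^ 2) := by
    rw [PiLp.norm_sq_eq_of_L2]
    refine Finset.sum_congr rfl fun k _ => ?_
    rw [hX]
    simp only [hnorm, RCLike.norm_conj]
  have hyn : ‖y‖ ^ 2 = ‖ξ‖ ^ 2 + ‖η‖ ^ 2 := by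
    rw [hy, hnorm, RCLike.norm_conj, RCLike.norm_conj]
  have hinner : inner ℂ y (rowOperator T X) = (‖X‖ ^ 2 : ℝ) := by
    have h1 : rowOperator T X = ∑ k, T k (X k) := by simp [rowOperator]
    rw [h1, inner_sum, hXn]
    push_cast
    refine Finset.sum_congr rfl fun k _ => ?_
    rw [hT, inner_lowerOp, ← Complex.mul_conj', ← Complex.mul_conj']
    simp [hy, hX, b.inner_eq_ite]
    ring
  rw [← hXn, ← hyn]
  have h2 : ‖X‖ ^ 2 ≤ ‖y‖ * (‖rowOperator T‖ * ‖X‖) := by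
    have := (norm_inner_le_norm (𝕜 := ℂ) y (rowOperator T X)).trans
      (mul_le_mul_of_nonneg_left ((rowOperator T).le_opNorm X) (norm_nonneg y))
    rwa [hinner, Complex.norm_real, Real.norm_of_nonneg (by positivity)] at this
  have h3 : ‖X‖ ≤ ‖rowOperator T‖ * ‖y‖ := by
    rcases (norm_nonneg X).eq_or_lt with h0 | h0
    · rw [← h0]; positivity
    · refine le_of_mul_le_mul_right ?_ h0
      linarith
  rw [← mul_pow]
  exact pow_le_pow_left₀ (norm_nonneg X) h3 2

end Triangularization

/-! ### Affine discs in the ball and Möbius maps -/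

section Geodesic

open Metric ComplexConjugate

theorem Complex.norm_sq_one_sub_conj_mul_sub (α δ : ℂ) :
    ‖1 - conj α * δ‖ ^ 2 - ‖δ - α‖ ^ 2 = (1 - ‖α‖ ^ 2) * (1 - ‖δ‖ ^ 2) := by
  simp only [← Complex.normSq_eq_norm_sq, Complex.normSq_apply, Complex.sub_re, Complex.sub_im,
    Complex.mul_re, Complex.mul_im, Complex.conj_re, Complex.conj_im, Complex.one_re,
    Complex.one_im]
  ring

theorem norm_sq_lt_of_lower_contraction {α β δ : ℂ} (hα : ‖α‖ < 1)
    (h : ∀ ξ η : ℂ, η ≠ 0 → ‖ξ * α + η * β‖ ^ 2 + ‖η * δ‖ ^ 2 < ‖ξ‖ ^ 2 + ‖η‖ ^ 2) :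
    ‖β‖ ^ 2 + ‖δ - α‖ ^ 2 < ‖1 - conj α * δ‖ ^ 2 := by
  have hα2 : 0 < 1 - ‖α‖ ^ 2 := by nlinarith [norm_nonneg α]
  -- For fixed `η`, the value `ξ = conj α * β * η / (1 - ‖α‖²)` maximizes `‖ξ α + η β‖² - ‖ξ‖²`; `η`
  -- is chosen to clear the denominator.
  have h1 := h (conj α * β) ((1 - ‖α‖ ^ 2 : ℝ) : ℂ) (by exact_mod_cast hα2.ne')
  have h2 : conj α * β * α + ((1 - ‖α‖ ^ 2 : ℝ) : ℂ) * β = β := by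
    push_cast
    rw [← Complex.conj_mul']
    ring
  rw [h2, norm_mul, norm_mul, RCLike.norm_conj, Complex.norm_real, Real.norm_of_nonneg hα2.le] at h1
  have h3 := Complex.norm_sq_one_sub_conj_mul_sub α δ
  have h4 : (1 - ‖α‖ ^ 2) * (‖β‖ ^ 2 - (1 - ‖α‖ ^ 2) * (1 - ‖δ‖ ^ 2)) < 0 := by nlinarith
  have h5 := neg_of_mul_neg_right h4 hα2.le
  linarith

variable {V : Type*} [NormedAddCommGroup V] [InnerProductSpace ℂ V]

/-- A strict row contraction `a + s X` with `X` a `2 × 2` matrix is an affine function of a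
strictly contractive `2 × 2` matrix, the affine function mapping the disc into the ball. -/
theorem exists_affine_disc (a s : V) (c z : ℂ) {τ : ℝ} (hτ : τ < 1)
    (h : ∀ ξ η : ℂ, ‖ξ • a + (η * c) • s‖ ^ 2 + ‖η • (a + z • s)‖ ^ 2 ≤
      τ * (‖ξ‖ ^ 2 + ‖η‖ ^ 2)) :
    ∃ (p e : V) (α γ : ℂ), a = p + α • e ∧ s = γ • e ∧ ‖α‖ < 1 ∧
      ‖γ * c‖ ^ 2 + ‖γ * z‖ ^ 2 < ‖1 - conj α * (α + γ * z)‖ ^ 2 ∧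
      ∀ w : ℂ, ‖w‖ ≤ 1 → ‖p + w • e‖ ≤ 1 := by
  have ha := h 1 0
  simp at ha
  rcases eq_or_ne s 0 with rfl | hs
  · refine ⟨a, 0, 0, 0, by simp, by simp, by simp, by simp, fun w _ => ?_⟩
    rw [smul_zero, add_zero]
    nlinarith [norm_nonneg a]
  have hs0 : 0 < ‖s‖ := norm_pos_iff.2 hs
  have hsc : (‖s‖ : ℂ) ≠ 0 := by exact_mod_cast hs0.ne'
  set e : V := (‖s‖ : ℂ)⁻¹ • s with he
  have hen : ‖e‖ = 1 := by simp [he, norm_smul, hs]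
  have hse : s = (‖s‖ : ℂ) • e := by rw [he, smul_inv_smul₀ hsc]
  set α' : ℂ := inner ℂ e a with hα'
  -- The component of `a` orthogonal to `s`. By Pythagoras it uses up `‖p‖²` of the row norm,
  -- leaving radius `σ = √(1 - ‖p‖²)` for the disc in direction `e`.
  set p : V := a - α' • e with hp
  have hpe : inner ℂ p e = 0 := by
    rw [hp, inner_sub_left, inner_smul_left, inner_self_eq_norm_sq_to_K, hen, hα',
      inner_conj_symm]
    simp
  have hap : a = p + α' • e := by rw [hp, sub_add_cancel]
  have hpyth : ∀ x y : ℂ, ‖x • p + y • e‖ ^ 2 = ‖x‖ ^ 2 * ‖p‖ ^ 2 + ‖y‖ ^ 2 := fun x y => by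
    have h0 : inner ℂ (x • p) (y • e) = 0 := by
      rw [inner_smul_left, inner_smul_right, hpe, mul_zero, mul_zero]
    rw [sq, norm_add_sq_eq_norm_sq_add_norm_sq_of_inner_eq_zero _ _ h0, norm_smul, norm_smul, hen]
    ring
  have key : ∀ ξ η : ℂ, ‖p‖ ^ 2 * (‖ξ‖ ^ 2 + ‖η‖ ^ 2) +
      (‖ξ * α' + η * (‖s‖ * c)‖ ^ 2 + ‖η * (α' + ‖s‖ * z)‖ ^ 2) ≤ τ * (‖ξ‖ ^ 2 + ‖η‖ ^ 2) := by
    intro ξ η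
    have h1 : ξ • a + (η * c) • s = ξ • p + (ξ * α' + η * (‖s‖ * c)) • e := by
      nth_rewrite 1 [hse]
      nth_rewrite 1 [hap]
      module
    have h2 : η • (a + z • s) = η • p + (η * (α' + ‖s‖ * z)) • e := by
      nth_rewrite 1 [hse]
      nth_rewrite 1 [hap]
      module
    have := h ξ η
    rw [h1, h2, hpyth, hpyth] at this
    linarith
  have hpα : ‖p‖ ^ 2 + ‖α'‖ ^ 2 ≤ τ := by simpa using key 1 0
  have hσ2 : 0 < 1 - ‖p‖ ^ 2 := by nlinarith [sq_nonneg ‖α'‖]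
  set σ : ℝ := Real.sqrt (1 - ‖p‖ ^ 2) with hσ
  have hσ0 : 0 < σ := Real.sqrt_pos.2 hσ2
  have hσsq : σ ^ 2 = 1 - ‖p‖ ^ 2 := Real.sq_sqrt hσ2.le
  have hσc : (σ : ℂ) ≠ 0 := by exact_mod_cast hσ0.ne'
  have hdiv : ∀ x : ℂ, ‖x / σ‖ ^ 2 = ‖x‖ ^ 2 / σ ^ 2 := fun x => by
    rw [norm_div, Complex.norm_real, Real.norm_of_nonneg hσ0.le, div_pow]
  have hα1 : ‖α' / σ‖ < 1 := by
    have : ‖α' / σ‖ ^ 2 < 1 := by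
      rw [hdiv, div_lt_one (by positivity), hσsq]
      linarith
    exact (sq_lt_one_iff₀ (norm_nonneg _)).1 this
  refine ⟨p, (σ : ℂ) • e, α' / σ, ‖s‖ / σ, ?_, ?_, hα1, ?_, fun w hw => ?_⟩
  · rw [smul_smul, div_mul_cancel₀ _ hσc, ← hap]
  · rw [smul_smul, div_mul_cancel₀ _ hσc, ← hse]
  · have := norm_sq_lt_of_lower_contraction (β := ‖s‖ / σ * c) (δ := α' / σ + ‖s‖ / σ * z) hα1 ?_
    · simpa using this
    · intro ξ η hη
      have h1 : ξ * (α' / σ) + η * (‖s‖ / σ * c) = (ξ * α' + η * (‖s‖ * c)) / σ := by ring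
      have h2 : η * (α' / σ + ‖s‖ / σ * z) = (η * (α' + ‖s‖ * z)) / σ := by ring
      rw [h1, h2, hdiv, hdiv, ← add_div, div_lt_iff₀ (by positivity), hσsq]
      have h3 : 0 < ‖ξ‖ ^ 2 + ‖η‖ ^ 2 := by
        have := norm_pos_iff.2 hη
        positivity
      nlinarith [key ξ η]
  · have h1 := hpyth 1 (w * σ)
    rw [one_smul, norm_one, norm_mul, Complex.norm_real, Real.norm_of_nonneg hσ0.le, mul_pow,
      hσsq] at h1
    rw [smul_smul]
    have h2 : ‖w‖ ^ 2 ≤ 1 := by nlinarith [norm_nonneg w]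
    have h3 : ‖p + (w * σ) • e‖ ^ 2 ≤ 1 := by nlinarith
    exact (sq_le_one_iff₀ (norm_nonneg _)).1 h3

/-- The automorphism of the unit disc that maps `0` to `α`. -/
noncomputable def discMoebius (α w : ℂ) : ℂ := (w + α) / (1 + conj α * w)

theorem one_add_conj_mul_ne_zero {α w : ℂ} (hα : ‖α‖ < 1) (hw : ‖w‖ ≤ 1) :
    1 + conj α * w ≠ 0 := by
  have := one_sub_conj_mul_ne_zero (ζ := -w) hα (by rwa [norm_neg])
  simpa using this

theorem norm_discMoebius_le {α w : ℂ} (hα : ‖α‖ < 1) (hw : ‖w‖ ≤ 1) : ‖discMoebius α w‖ ≤ 1 := by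
  have h0 := one_add_conj_mul_ne_zero hα hw
  rw [discMoebius, norm_div, div_le_one (norm_pos_iff.2 h0)]
  have h1 := Complex.norm_sq_one_sub_conj_mul_sub (-α) w
  simp only [map_neg, neg_mul, sub_neg_eq_add, norm_neg] at h1
  refine abs_le_of_sq_le_sq' ?_ (norm_nonneg _) |>.2
  have h2 : 0 ≤ (1 - ‖α‖ ^ 2) * (1 - ‖w‖ ^ 2) :=
    mul_nonneg (by nlinarith [norm_nonneg α]) (by nlinarith [norm_nonneg w])
  linarith

theorem discMoebius_zero (α : ℂ) : discMoebius α 0 = α := by simp [discMoebius]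

theorem discMoebius_eq {α w : ℂ} (hα : ‖α‖ < 1) (hw : ‖w‖ ≤ 1) :
    discMoebius α w = α + w * ((1 - conj α * α) / (1 + conj α * w)) := by
  have h0 := one_add_conj_mul_ne_zero hα hw
  rw [discMoebius, mul_div_assoc', ← sub_eq_iff_eq_add', div_sub' h0]
  congr 1
  ring

theorem dslope_zero_eq_of_eq_add_mul {f g : ℂ → ℂ} {a z : ℂ} (hz : ‖z‖ < 1)
    (hfg : ∀ w : ℂ, ‖w‖ < 1 → f w = a + w * g w) (hg : DifferentiableAt ℂ g 0) :
    dslope f 0 z = g z := by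
  have h0 : f 0 = a := by simpa using hfg 0 (by simp)
  rcases eq_or_ne z 0 with rfl | hz0
  · have h1 : f =ᶠ[nhds 0] fun w => a + w * g w := by
      filter_upwards [ball_mem_nhds (0 : ℂ) one_pos] with w hw
      exact hfg w (by simpa using hw)
    rw [dslope_same, h1.deriv_eq]
    have := ((hasDerivAt_id (0 : ℂ)).mul hg.hasDerivAt).const_add a
    simpa using this.deriv
  · rw [dslope_of_ne _ hz0, slope_def_field, hfg z hz, h0]
    field_simp
    ring

end Geodesic

/-! ### One contraction generating the whole tuple -/

section DiscModel

open Metric ComplexConjugate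

variable {H : Type*} [NormedAddCommGroup H] [InnerProductSpace ℂ H]

theorem exists_common_bound {d : ℕ} (g : Fin d → ℂ) (L : ℝ)
    (h : ∀ r, ‖g r‖ ^ 2 * L < 1) : ∃ G : ℝ, 0 ≤ G ∧ G ^ 2 * L < 1 ∧ ∀ r, ‖g r‖ ≤ G := by
  rcases isEmpty_or_nonempty (Fin d) with hd | hd
  · exact ⟨0, le_rfl, by simp, fun r => (hd.false r).elim⟩
  · obtain ⟨r, -, hr⟩ := Finset.exists_max_image Finset.univ (fun r => ‖g r‖) Finset.univ_nonempty
    exact ⟨‖g r‖, norm_nonneg _, h r, fun s => hr s (Finset.mem_univ s)⟩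

theorem exists_disc_model [FiniteDimensional ℂ H] (hH : Module.finrank ℂ H = 2)
    {d : ℕ} {n : Fin d → ℕ} (T : (r : Fin d) → Fin (n r) → H →L[ℂ] H)
    (hrow : ∀ r, ‖rowOperator (T r)‖ < 1)
    (hcomm : ∀ i j : Σ r : Fin d, Fin (n r), Commute (T i.1 i.2) (T j.1 j.2)) :
    ∃ (b : OrthonormalBasis (Fin 2) ℂ H) (c z : ℂ) (ψ : (Σ r : Fin d, Fin (n r)) → ℂ → ℂ),
      ‖c‖ ^ 2 + ‖z‖ ^ 2 ≤ 1 ∧ ‖z‖ < 1 ∧ (∀ i, DifferentiableOn ℂ (ψ i) (closedBall 0 1)) ∧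
      (∀ w : ℂ, ‖w‖ ≤ 1 → (fun i => ψ i w) ∈ closedPolyball n) ∧
      ∀ i, T i.1 i.2 = discCalculus b c z (ψ i) := by
  obtain ⟨b, a, β, δ, hT⟩ := exists_lowerOp_eq hH
    (fun i : Σ r : Fin d, Fin (n r) => T i.1 i.2) hcomm
  obtain ⟨s, c₀, z₀, hs⟩ := exists_common_direction b (α := a) (β := β) (δ := δ)
    fun i j => by rw [← hT, ← hT]; exact hcomm i j
  have hfib : ∀ r, ∃ (p e : EuclideanSpace ℂ (Fin (n r))) (α γ : ℂ),
      WithLp.toLp 2 (fun k => a ⟨r, k⟩) = p + α • e ∧ WithLp.toLp 2 (fun k => s ⟨r, k⟩) = γ • e ∧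
      ‖α‖ < 1 ∧ ‖γ * c₀‖ ^ 2 + ‖γ * z₀‖ ^ 2 < ‖1 - conj α * (α + γ * z₀)‖ ^ 2 ∧
      ∀ w : ℂ, ‖w‖ ≤ 1 → ‖p + w • e‖ ≤ 1 := fun r => by
    have hτ : ‖rowOperator (T r)‖ ^ 2 < 1 := by
      have := hrow r
      nlinarith [norm_nonneg (rowOperator (T r))]
    refine exists_affine_disc _ _ c₀ z₀ hτ fun ξ η => ?_
    refine le_trans (le_of_eq ?_) (sum_norm_sq_le_of_rowOperator b (α := fun k => a ⟨r, k⟩)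
      (β := fun k => β ⟨r, k⟩) (δ := fun k => δ ⟨r, k⟩) (fun k => hT ⟨r, k⟩) ξ η)
    rw [EuclideanSpace.norm_sq_eq, EuclideanSpace.norm_sq_eq, ← Finset.sum_add_distrib]
    refine Finset.sum_congr rfl fun k _ => ?_
    simp only [PiLp.add_apply, PiLp.smul_apply, smul_eq_mul, (hs _).1, (hs _).2]
    ring_nf
  choose p e α γ ha hse hα hlt hball using hfib
  have hden : ∀ r, 1 - conj (α r) * (α r + γ r * z₀) ≠ 0 := fun r h0 => by
    have := hlt r
    rw [h0, norm_zero] at this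
    have h1 : 0 ≤ ‖γ r * c₀‖ ^ 2 + ‖γ r * z₀‖ ^ 2 := by positivity
    linarith
  -- With `X = !![0, 0; c₀, z₀]`, the automorphism taking `α r` to `0` sends `α r + γ r X` to this
  -- multiple of `X`: the image function vanishes at `0`, so only its quotient at `z₀` matters.
  obtain ⟨G, hG0, hG, hgG⟩ := exists_common_bound
    (fun r => γ r / (1 - conj (α r) * (α r + γ r * z₀))) (‖c₀‖ ^ 2 + ‖z₀‖ ^ 2) fun r => by
      have := hlt r
      have h2 := norm_pos_iff.2 (hden r)
      rw [norm_div, div_pow, div_mul_eq_mul_div, div_lt_one (by positivity)]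
      simp only [norm_mul, mul_pow] at this
      linarith
  set g : Fin d → ℂ := fun r => γ r / (1 - conj (α r) * (α r + γ r * z₀)) with hg
  -- If `G = 0`, division by zero yields `t r = 0`, which is right because then every `g r`
  -- vanishes.
  set t : Fin d → ℂ := fun r => g r / G with ht
  have htG : ∀ r, t r * G = g r := fun r => by
    rcases hG0.eq_or_lt with h0 | h0
    · have : g r = 0 := norm_le_zero_iff.1 (h0 ▸ hgG r)
      rw [ht]; simp [this]
    · have : (G : ℂ) ≠ 0 := by exact_mod_cast h0.ne'
      exact div_mul_cancel₀ _ this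
  have ht1 : ∀ r, ‖t r‖ ≤ 1 := fun r => by
    rw [ht, norm_div, Complex.norm_real, Real.norm_of_nonneg hG0]
    exact div_le_one_of_le₀ (hgG r) hG0
  have htw : ∀ r (w : ℂ), ‖w‖ ≤ 1 → ‖t r * w‖ ≤ 1 := fun r w hw => by
    rw [norm_mul]; exact mul_le_one₀ (ht1 r) (norm_nonneg _) hw
  have hcz : ‖(G : ℂ) * c₀‖ ^ 2 + ‖(G : ℂ) * z₀‖ ^ 2 < 1 := by
    rw [norm_mul, norm_mul, Complex.norm_real, Real.norm_of_nonneg hG0]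
    linarith
  have hz : ‖(G : ℂ) * z₀‖ < 1 := by
    refine (sq_lt_one_iff₀ (norm_nonneg _)).1 ?_
    linarith [sq_nonneg ‖(G : ℂ) * c₀‖]
  refine ⟨b, G * c₀, G * z₀, fun i w => p i.1 i.2 + discMoebius (α i.1) (t i.1 * w) * e i.1 i.2,
    hcz.le, hz, ?_, ?_, ?_⟩
  · intro i
    unfold discMoebius
    refine DifferentiableOn.const_add _ (DifferentiableOn.mul_const
      (DifferentiableOn.div (by fun_prop) (by fun_prop) fun w hw => ?_) _)
    exact one_add_conj_mul_ne_zero (hα _) (htw _ _ (by simpa using hw))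
  · intro w hw r
    rw [mem_closedBall_zero_iff]
    refine le_trans (le_of_eq ?_) (hball r _ (norm_discMoebius_le (hα r) (htw r w hw)))
    congr 1
  · rintro ⟨r, k⟩
    have hak : a ⟨r, k⟩ = p r k + α r * e r k := congrArg (fun v => v.ofLp k) (ha r)
    have hsk : s ⟨r, k⟩ = γ r * e r k := congrArg (fun v => v.ofLp k) (hse r)
    set ψ : ℂ → ℂ := fun w => p r k + discMoebius (α r) (t r * w) * e r k with hψ
    set h : ℂ → ℂ := fun w => t r * ((1 - conj (α r) * α r) / (1 + conj (α r) * (t r * w))) * e r k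
      with hh
    have hψ0 : ψ 0 = a ⟨r, k⟩ := by rw [hψ]; simp only [mul_zero, discMoebius_zero, hak]
    have hsl : dslope ψ 0 (G * z₀) = h (G * z₀) := by
      refine dslope_zero_eq_of_eq_add_mul (a := a ⟨r, k⟩) hz (fun w hw => ?_) ?_
      · simp only [hψ, hh, discMoebius_eq (hα r) (htw r w hw.le), hak]
        ring
      · refine DifferentiableAt.mul_const (DifferentiableAt.const_mul
          (DifferentiableAt.div (by fun_prop) (by fun_prop) (by simp)) _) _
    -- This single identity matches both remaining entries: multiplied by `c₀` it gives the corner,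
    -- multiplied by `z₀` the difference of the diagonal entries.
    have hGh : (G : ℂ) * h (G * z₀) = s ⟨r, k⟩ := by
      have h1 := one_add_conj_mul_ne_zero (hα r) (htw r _ hz.le)
      have h2 : t r * (G * z₀) = g r * z₀ := by rw [← mul_assoc, htG]
      have h3 : (G : ℂ) * h (G * z₀) =
          g r * ((1 - conj (α r) * α r) / (1 + conj (α r) * (g r * z₀))) * e r k := by
        simp only [hh, h2, ← htG]
        ring
      rw [h2] at h1
      have h4 : (1 + conj (α r) * (g r * z₀)) * (1 - conj (α r) * (α r + γ r * z₀)) =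
          1 - conj (α r) * α r := by
        have := hden r
        simp only [hg]
        field_simp
        ring
      have h5 : g r * (1 - conj (α r) * (α r + γ r * z₀)) = γ r := div_mul_cancel₀ _ (hden r)
      rw [h3, hsk, ← h4, mul_div_cancel_left₀ _ h1, h5]
    have hψz : ψ (G * z₀) = ψ 0 + G * z₀ * dslope ψ 0 (G * z₀) := by
      have := sub_smul_dslope ψ 0 (G * z₀)
      rw [sub_zero, smul_eq_mul] at this
      rw [this]; ring
    refine (hT ⟨r, k⟩).trans ?_
    change _ = discCalculus b (G * c₀) (G * z₀) ψ
    rw [discCalculus, hψz, hψ0, hsl, (hs _).1, (hs _).2, ← hGh]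
    congr 1 <;> ring

end DiscModel

/-! ### Rational functions and the passage to the limit -/

section CompleteSpectralSet

open Metric ComplexConjugate

variable {H : Type*} [NormedAddCommGroup H] [InnerProductSpace ℂ H]

theorem discCalculus_congr (b : OrthonormalBasis (Fin 2) ℂ H) {c z : ℂ} (hz : ‖z‖ < 1)
    {f g : ℂ → ℂ} (h : ∀ w : ℂ, ‖w‖ < 1 → f w = g w) :
    discCalculus b c z f = discCalculus b c z g := by
  have h0 : f 0 = g 0 := h 0 (by simp)
  have hd : dslope f 0 z = dslope g 0 z := by
    rcases eq_or_ne z 0 with rfl | hz0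
    · rw [dslope_same, dslope_same]
      refine Filter.EventuallyEq.deriv_eq ?_
      filter_upwards [ball_mem_nhds (0 : ℂ) one_pos] with w hw
      exact h w (by simpa using hw)
    · rw [dslope_of_ne _ hz0, dslope_of_ne _ hz0, slope_def_field, slope_def_field, h0, h z hz]
  rw [discCalculus, discCalculus, hd, h0, h z hz]

theorem isUnit_lowerOp (b : OrthonormalBasis (Fin 2) ℂ H) {α β δ : ℂ} (hα : α ≠ 0) (hδ : δ ≠ 0) :
    IsUnit (lowerOp b α β δ) := by
  refine ⟨⟨lowerOp b α β δ, lowerOp b α⁻¹ (-(β / (α * δ))) δ⁻¹, ?_, ?_⟩, rfl⟩ <;>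
  · rw [lowerOp_mul, ← one_smul ℂ (1 : H →L[ℂ] H), ← lowerOp_scalar b]
    congr 1 <;> field_simp
    ring

theorem exists_polyCalculus_eq_lowerOp {ι : Type*} (b : OrthonormalBasis (Fin 2) ℂ H)
    {T : ι → H →L[ℂ] H} (hT : ∀ i j, Commute (T i) (T j)) {α β δ : ι → ℂ}
    (h : ∀ i, T i = lowerOp b (α i) (β i) (δ i)) (p : MvPolynomial ι ℂ) :
    ∃ γ, polyCalculus T hT p = lowerOp b (MvPolynomial.eval α p) γ (MvPolynomial.eval δ p) := by
  induction p using MvPolynomial.induction_on with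
  | C a => exact ⟨0, by rw [polyCalculus_C, MvPolynomial.eval_C, MvPolynomial.eval_C,
      lowerOp_scalar]⟩
  | add p q hp hq =>
    obtain ⟨γ, hγ⟩ := hp
    obtain ⟨γ', hγ'⟩ := hq
    exact ⟨γ + γ', by simp only [map_add, hγ, hγ', lowerOp_add]⟩
  | mul_X p i hp =>
    obtain ⟨γ, hγ⟩ := hp
    exact ⟨γ * α i + MvPolynomial.eval δ p * β i, by
      simp only [map_mul, hγ, polyCalculus_X, MvPolynomial.eval_X, h i, lowerOp_mul]⟩

variable {d : ℕ} {n : Fin d → ℕ}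

/-- The two diagonals of the triangular tuple are points of the polyball, as the column bound at
`(1, 0)` and `(0, 1)` shows. Hence `q(T)` is triangular with nonzero diagonal. -/
theorem isUnit_polyCalculus [FiniteDimensional ℂ H] (hH : Module.finrank ℂ H = 2)
    (T : (r : Fin d) → Fin (n r) → H →L[ℂ] H) (hrow : ∀ r, IsRowContraction (T r))
    (hcomm : ∀ i j : Σ r : Fin d, Fin (n r), Commute (T i.1 i.2) (T j.1 j.2))
    (q : MvPolynomial (Σ r : Fin d, Fin (n r)) ℂ)
    (hq : ∀ z ∈ closedPolyball n, MvPolynomial.eval z q ≠ 0) :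
    IsUnit (polyCalculus (fun i : Σ r : Fin d, Fin (n r) => T i.1 i.2) hcomm q) := by
  obtain ⟨b, α, β, δ, hT⟩ := exists_lowerOp_eq hH
    (fun i : Σ r : Fin d, Fin (n r) => T i.1 i.2) hcomm
  obtain ⟨γ, hγ⟩ := exists_polyCalculus_eq_lowerOp b hcomm hT q
  have hsum := fun r => sum_norm_sq_le_of_rowOperator b (α := fun k => α ⟨r, k⟩)
      (β := fun k => β ⟨r, k⟩) (δ := fun k => δ ⟨r, k⟩) (fun k => hT ⟨r, k⟩)
  have hle : ∀ r, ‖rowOperator (T r)‖ ^ 2 ≤ 1 := fun r => pow_le_one₀ (ContinuousLinearMap.opNorm_nonneg _) (hrow r)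
  rw [hγ]
  refine isUnit_lowerOp b (hq α ?_) (hq δ ?_) <;> rw [mem_closedPolyball_iff] <;> intro r
  · have h1 := hsum r 1 0
    simp only [one_mul, zero_mul, add_zero, norm_one, norm_zero] at h1
    norm_num at h1
    exact h1.trans (hle r)
  · have h1 := hsum r 0 1
    simp only [one_mul, zero_mul, zero_add, norm_one, norm_zero, Finset.sum_add_distrib] at h1
    norm_num at h1
    have h2 : 0 ≤ ∑ k, ‖β ⟨r, k⟩‖ ^ 2 := by positivity
    have := hle r
    linarith

variable {m : ℕ}

theorem norm_rationalCalculus_le_of_strict [FiniteDimensional ℂ H] (hH : Module.finrank ℂ H = 2)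
    (T : (r : Fin d) → Fin (n r) → H →L[ℂ] H) (hrow : ∀ r, ‖rowOperator (T r)‖ < 1)
    (hcomm : ∀ i j : Σ r : Fin d, Fin (n r), Commute (T i.1 i.2) (T j.1 j.2))
    (P Q : Matrix (Fin m) (Fin m) (MvPolynomial (Σ r : Fin d, Fin (n r)) ℂ))
    (hQ : ∀ i j, ∀ z ∈ closedPolyball n, MvPolynomial.eval z (Q i j) ≠ 0) {M : ℝ}
    (hM : ∀ z ∈ closedPolyball n,
      ‖Matrix.toEuclideanCLM (n := Fin m) (𝕜 := ℂ) (rationalValue P Q z)‖ ≤ M) :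
    ‖rationalCalculus P Q (fun i : Σ r : Fin d, Fin (n r) => T i.1 i.2) hcomm‖ ≤ M := by
  obtain ⟨b, c, z, ψ, hcz, hz, hψ, hψK, hTψ⟩ := exists_disc_model hH T hrow hcomm
  have h0 : closedBall (0 : ℂ) 1 ∈ nhds 0 := closedBall_mem_nhds _ one_pos
  set F : Matrix (Fin m) (Fin m) (ℂ → ℂ) := Matrix.of fun i j w =>
    MvPolynomial.eval (fun i => ψ i w) (P i j) / MvPolynomial.eval (fun i => ψ i w) (Q i j) with hF
  have hFd : ∀ i j, DifferentiableOn ℂ (F i j) (closedBall 0 1) := fun i j =>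
    (differentiableOn_eval_comp hψ _).fun_div (differentiableOn_eval_comp hψ _)
      fun w hw => hQ i j _ (hψK w (by simpa using hw))
  have hentry : ∀ i j, polyCalculus _ hcomm (P i j) * Ring.inverse (polyCalculus _ hcomm (Q i j)) =
      discCalculus b c z (F i j) := fun i j => by
    symm
    rw [Ring.eq_mul_inverse_iff_mul_eq _ _ _
      (isUnit_polyCalculus hH T (fun r => (hrow r).le) hcomm _ (hQ i j)),
      polyCalculus_eq_discCalculus b _ hcomm hψ hTψ, polyCalculus_eq_discCalculus b _ hcomm hψ hTψ,
      ← discCalculus_mul b ((hFd i j).differentiableAt h0)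
        ((differentiableOn_eval_comp hψ _).differentiableAt h0)]
    -- The quotient times its denominator is the numerator only where the denominator is nonzero;
    -- agreement on the open disc determines the operator.
    exact discCalculus_congr b hz fun w hw => div_mul_cancel₀ _ (hQ i j _ (hψK w hw.le))
  rw [rationalCalculus]
  simp only [hentry]
  exact norm_blockOperator_discCalculus_le b hcz hz F hFd
    ((norm_nonneg _).trans (hM 0 zero_mem_closedPolyball))
    fun ζ hζ => hM _ (hψK ζ hζ.le)

theorem continuous_polyCalculus_smul {ι : Type*} (T : ι → H →L[ℂ] H)
    (hT : ∀ (t : ℂ) (i j), Commute (t • T i) (t • T j)) (p : MvPolynomial ι ℂ) :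
    Continuous fun t : ℂ => polyCalculus (fun i => t • T i) (hT t) p := by
  induction p using MvPolynomial.induction_on with
  | C a => simp only [polyCalculus_C]; exact continuous_const
  | add p q hp hq => simp only [map_add]; exact hp.add hq
  | mul_X p i hp =>
    simp only [map_mul, polyCalculus_X]
    exact hp.mul (by fun_prop)

theorem continuousAt_rationalCalculus_smul_apply [CompleteSpace H] {ι : Type*}
    (T : ι → H →L[ℂ] H)
    (hT : ∀ (t : ℂ) (i j), Commute (t • T i) (t • T j)) {t : ℂ}
    (P Q : Matrix (Fin m) (Fin m) (MvPolynomial ι ℂ))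
    (hQ : ∀ i j, IsUnit (polyCalculus (fun i => t • T i) (hT t) (Q i j)))
    (X : PiLp 2 (fun _ : Fin m => H)) :
    ContinuousAt (fun t : ℂ => rationalCalculus P Q (fun i => t • T i) (hT t) X) t := by
  have h : ∀ t : ℂ, rationalCalculus P Q (fun i => t • T i) (hT t) X = WithLp.toLp 2 fun i =>
      ∑ j, (polyCalculus (fun i => t • T i) (hT t) (P i j) *
        Ring.inverse (polyCalculus (fun i => t • T i) (hT t) (Q i j))) (X j) := fun t => by
    ext i
    rw [rationalCalculus, blockOperator_apply]
    rfl
  simp only [h]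
  refine (PiLp.continuous_toLp 2 _).continuousAt.comp (continuousAt_pi.2 fun i => ?_)
  refine tendsto_finsetSum _ fun j _ => ?_
  have h1 : ContinuousAt (fun t => Ring.inverse (polyCalculus (fun i => t • T i) (hT t) (Q i j))) t :=
    ContinuousAt.comp (g := Ring.inverse)
      (f := fun t => polyCalculus (fun i => t • T i) (hT t) (Q i j))
      (by
        obtain ⟨u, hu⟩ := hQ i j
        rw [← hu]
        exact NormedRing.inverse_continuousAt u)
      (continuous_polyCalculus_smul T hT _).continuousAt
  exact ((continuous_polyCalculus_smul T hT _).continuousAt.mul h1).clm_apply continuousAt_const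

theorem rowOperator_smul {κ : Type*} [Fintype κ] (t : ℂ) (T : κ → H →L[ℂ] H) :
    rowOperator (fun k => t • T k) = t • rowOperator T := by
  simp [rowOperator, Finset.smul_sum]

theorem norm_rationalCalculus_le [FiniteDimensional ℂ H] (hH : Module.finrank ℂ H = 2)
    (T : (r : Fin d) → Fin (n r) → H →L[ℂ] H) (hrow : ∀ r, IsRowContraction (T r))
    (hcomm : ∀ i j : Σ r : Fin d, Fin (n r), Commute (T i.1 i.2) (T j.1 j.2))
    (P Q : Matrix (Fin m) (Fin m) (MvPolynomial (Σ r : Fin d, Fin (n r)) ℂ))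
    (hQ : ∀ i j, ∀ z ∈ closedPolyball n, MvPolynomial.eval z (Q i j) ≠ 0) {M : ℝ}
    (hM : ∀ z ∈ closedPolyball n,
      ‖Matrix.toEuclideanCLM (n := Fin m) (𝕜 := ℂ) (rationalValue P Q z)‖ ≤ M) :
    ‖rationalCalculus P Q (fun i : Σ r : Fin d, Fin (n r) => T i.1 i.2) hcomm‖ ≤ M := by
  have : CompleteSpace H := FiniteDimensional.complete ℂ H
  have hcomm' : ∀ (t : ℂ) (i j : Σ r : Fin d, Fin (n r)),
      Commute (t • T i.1 i.2) (t • T j.1 j.2) := fun t i j =>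
    ((hcomm i j).smul_right t).smul_left t
  have hone : (fun i : Σ r : Fin d, Fin (n r) => (1 : ℂ) • T i.1 i.2) = fun i => T i.1 i.2 := by
    simp only [one_smul]
  have hunit : ∀ i j, IsUnit (polyCalculus
      (fun i : Σ r : Fin d, Fin (n r) => (1 : ℂ) • T i.1 i.2) (hcomm' 1) (Q i j)) := fun i j => by
    simp only [hone]
    exact isUnit_polyCalculus hH T hrow hcomm _ (hQ i j)
  have hM0 : 0 ≤ M := (norm_nonneg _).trans (hM 0 zero_mem_closedPolyball)
  refine ContinuousLinearMap.opNorm_le_bound _ hM0 fun X => ?_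
  have hlim : Filter.Tendsto (fun t : ℝ => ‖rationalCalculus P Q
      (fun i : Σ r : Fin d, Fin (n r) => (t : ℂ) • T i.1 i.2) (hcomm' t) X‖) (nhdsWithin 1 (Set.Iio 1))
      (nhds ‖rationalCalculus P Q (fun i : Σ r : Fin d, Fin (n r) => T i.1 i.2) hcomm X‖) := by
    have h1 := (continuousAt_rationalCalculus_smul_apply
      (fun i : Σ r : Fin d, Fin (n r) => T i.1 i.2) hcomm' P Q hunit X).norm
    have h2 : ContinuousAt (fun t : ℝ => (t : ℂ)) 1 := Complex.continuous_ofReal.continuousAt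
    have h3 := ContinuousAt.comp_of_eq h1 h2 Complex.ofReal_one
    have h4 := h3.tendsto.mono_left (nhdsWithin_le_nhds (s := Set.Iio 1))
    simpa only [Function.comp_def, Complex.ofReal_one, hone] using h4
  -- For `0 < t < 1` the scaled rows are strict contractions and obey the same bound `M`. Continuity
  -- at `t = 1` only needs the denominators to be invertible there.
  refine le_of_tendsto hlim ?_
  filter_upwards [Ioo_mem_nhdsLT (zero_lt_one' ℝ)] with t ht
  refine ContinuousLinearMap.le_of_opNorm_le _ ?_ X
  refine norm_rationalCalculus_le_of_strict hH (fun r k => (t : ℂ) • T r k) (fun r => ?_)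
    (hcomm' t) P Q hQ hM
  rw [rowOperator_smul]
  refine (ContinuousLinearMap.opNorm_smul_le (t : ℂ) (rowOperator (T r))).trans_lt ?_
  rw [Complex.norm_real, Real.norm_of_nonneg ht.1.le]
  exact (mul_le_of_le_one_right ht.1.le (hrow r)).trans_lt ht.2

theorem continuousOn_rationalValue {ι : Type*} [Fintype ι]
    (P Q : Matrix (Fin m) (Fin m) (MvPolynomial ι ℂ)) {K : Set (ι → ℂ)}
    (hQ : ∀ i j, ∀ z ∈ K, MvPolynomial.eval z (Q i j) ≠ 0) :
    ContinuousOn (rationalValue P Q) K := by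
  refine continuousOn_pi.2 fun i => continuousOn_pi.2 fun j => ?_
  exact (MvPolynomial.continuous_eval _).continuousOn.div
    (MvPolynomial.continuous_eval _).continuousOn (hQ i j)

/-- Compactness makes the supremum genuine: an unbounded real supremum would default to `0`. -/
theorem bddAbove_range_norm_rationalValue {ι : Type*} [Fintype ι]
    (P Q : Matrix (Fin m) (Fin m) (MvPolynomial ι ℂ)) {K : Set (ι → ℂ)} (hK : IsCompact K)
    (hQ : ∀ i j, ∀ z ∈ K, MvPolynomial.eval z (Q i j) ≠ 0) :
    BddAbove (Set.range fun z : K =>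
      ‖Matrix.toEuclideanCLM (n := Fin m) (𝕜 := ℂ) (rationalValue P Q z)‖) := by
  have hc : Continuous (Matrix.toEuclideanCLM (n := Fin m) (𝕜 := ℂ)) :=
    (Matrix.toEuclideanCLM (n := Fin m) (𝕜 := ℂ)).toAlgEquiv.toLinearMap.continuous_of_finiteDimensional
  have h := hK.bddAbove_image (hc.comp_continuousOn (continuousOn_rationalValue P Q hQ)).norm
  rwa [Set.image_eq_range] at h

end CompleteSpectralSet

theorem mainTheorem7 (d : ℕ) (n : Fin d → ℕ)
    (T : (r : Fin d) → Fin (n r) →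
      EuclideanSpace ℂ (Fin 2) →L[ℂ] EuclideanSpace ℂ (Fin 2))
    (hrow : ∀ r, IsRowContraction (T r))
    (hcomm : ∀ i j : Σ r : Fin d, Fin (n r), Commute (T i.1 i.2) (T j.1 j.2)) :
    IsCompleteSpectralSet (closedPolyball n)
      (fun i : Σ r : Fin d, Fin (n r) => T i.1 i.2) hcomm := by
  have hH : Module.finrank ℂ (EuclideanSpace ℂ (Fin 2)) = 2 := by simp
  refine ⟨isCompact_closedPolyball, taylorSpectrum_subset_closedPolyball T hrow hcomm,
    fun m P Q hQ => ⟨fun i j => isUnit_polyCalculus hH T hrow hcomm _ (hQ i j), ?_⟩⟩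
  refine norm_rationalCalculus_le hH T hrow hcomm P Q hQ fun z hz => ?_
  exact le_ciSup (bddAbove_range_norm_rationalValue P Q isCompact_closedPolyball hQ)
    (⟨z, hz⟩ : closedPolyball n)
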